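/- **Setting.** Fix $r$ and a probability space. For $i,t\ge 1$ let $x_{it}=\Lambda_i^{0\prime}F_t^0+e_{it}$, with $F^0_t,\Lambda^0_i\in\mathbb R^r$ random vectors (the loadings $\Lambda_i^0$ may depend on $N$) and $e_{it}$ square-integrable random variables. For $i\le N$, $t\le T$ let $\mathbf X=(x_{it})$ and $\mathbf e=(e_{it})$ be the $T\times N$ data and error matrices, $\mathbf F^0$ ($T\times r$) and $\mathbf\Lambda^0$ ($N\times r$) the matrices with rows $F_t^{0\prime}$ and $\Lambda_i^{0\prime}$, so $\mathbf X=\mathbf F^0\mathbf\Lambda^{0\prime}+\mathbf e$; let $e_t=(e_{1t},\dots,e_{Nt})'$, $e_i=(e_{i1},\dots,e_{iT})'$, $\delta_{NT}=\min(\sqrt N,\sqrt T)$. $\|\cdot\|$ is the Euclidean/Frobenius norm. All limits are along a path (a sequence of pairs $(N,T)$) with $N,T\to\infty$, and $M<\infty$ is a constant not depending on $N,T$. **Assumption A.** A1: (i) $E(e_{it}\mid\Lambda_i^0,F_t^0)=0$; (ii)(a) $E\big[N^{-1/2}\sum_{i\le N}(e_{it}e_{is}-E(e_{it}e_{is}))\big]^2\le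 M$ for all $t,s$; (b) $\frac1T\sum_{t,s\le T}|E(e_{it}e_{is})|\le M$ for all $i$, and $\frac1N\sum_{i,j\le N}|E(e_{it}e_{jt})|\le M$ for all $t$; (c) $\frac1{N\sqrt T}\|e_t'\mathbf e'\|=O_p(\delta_{NT}^{-1})$ for each $t$, and $\frac1{T\sqrt N}\|e_i'\mathbf e\|=O_p(\delta_{NT}^{-1})$ for each $i$; (d) $\rho_{\max}(\mathbf e'\mathbf e)=O_p(\max\{N,T\})$, where $\rho_{\max}$ is the largest eigenvalue. A2: (i) $E\|F^0_t\|^4\le M$ for all $t$, and $\mathbf F^{0\prime}\mathbf F^0/T\to_p\Sigma_F$, positive definite; (ii) $\|\Lambda_i^0\|\le M$ almost surely, and $\mathbf\Lambda^{0\prime}\mathbf\Lambda^0/N^\alpha\to_p\Sigma_\Lambda$, positive definite, for some $\alpha\in(0,1]$; (iii) the eigenvalues of $\Sigma_\Lambda\Sigma_F$ are distinct. A3: for all $t$, (i) $E\|N^{-\alpha/2}\sum_{i\le N}\Lambda_i^0e_{it}\|^2\le M$, and for each $t$, (ii) $\frac1{NT}e_t'\mathbf e'\mathbf F^0=O_p(\delta_{NT}^{-2})$;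 for all $i$, (iii) $E\|T^{-1/2}\sum_{t\le T}F_t^0e_{it}\|^2\le M$, and for each $i$, (iv) $\frac1{N^\alpha T}e_i'\mathbf e\mathbf\Lambda^0=O_p(N^{-\alpha})+O_p((TN^\alpha)^{-1/2})$; (v) $\mathbf\Lambda^{0\prime}\mathbf e'\mathbf F^0=O_p(\sqrt{N^\alpha T})$. A4: $\frac{N}{N^\alpha}\frac1T\to0$. **Assumption B.** For each $t$ and each $i$, $N^{-\alpha/2}\sum_{i\le N}\Lambda_i^0e_{it}\to_d\mathcal N(0,\Gamma_t)$ and $T^{-1/2}\sum_{t\le T}F_t^0e_{it}\to_d\mathcal N(0,\Phi_i)$, with $\Gamma_t,\Phi_i$ positive definite. **Assumption C.** $\alpha>\tfrac12$, $\ \sqrt T/N^\alpha\to0$, $\ \frac1{\sqrt T}\frac N{N^\alpha}\to0$, $\ \frac1T\frac{N^{3/2}}{N^\alpha}\to0$. **Estimator.** For $r\le\min(N,T)$ let $\mathbf X/\sqrt{NT}=\mathbf U\mathbf D\mathbf V'$ be a singular value decomposition with singular values in decreasing order, let $\mathbf U_r,\mathbf V_r$ consist of the first $r$ columns of $\mathbf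 U,\mathbf V$ and let $\mathbf D_{NT,r}$ be the diagonal matrix of the $r$ largest singular values. Put $\tilde{\mathbf F}=\sqrt T\,\mathbf U_r$ and $\tilde{\mathbf\Lambda}=\sqrt N\,\mathbf V_r\mathbf D_{NT,r}$ (so $\tilde{\mathbf F}'\tilde{\mathbf F}/T=I_r$ and $\tilde{\mathbf\Lambda}'\tilde{\mathbf\Lambda}$ is diagonal), chosen measurably, with rows $\tilde F_t'$ and $\tilde\Lambda_i'$. Put $$\mathbf H_{NT,3}=(\tilde{\mathbf F}'\mathbf F^0)^{-1}(\tilde{\mathbf F}'\tilde{\mathbf F}),\qquad \mathbf H_{NT,4}=(\mathbf\Lambda^{0\prime}\tilde{\mathbf\Lambda})(\tilde{\mathbf\Lambda}'\tilde{\mathbf\Lambda})^{-1}.$$ Let $\mathbf D_r^2$ be the diagonal matrix of the eigenvalues of $\Sigma_\Lambda\Sigma_F$ in decreasing order, $\mathbf D_r$ its positive square root, $\Upsilon$ an orthogonal matrix whose columns are eigenvectors of $\Sigma_\Lambda^{1/2}\Sigma_F\Sigma_\Lambda^{1/2}$ in the same order, and $\mathbf Q=\mathbf D_r\Upsilon'\Sigma_\Lambda^{-1/2}$.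 Since $\Upsilon$ (hence each row of $\mathbf Q$) and the columns of $(\tilde{\mathbf F},\tilde{\mathbf\Lambda})$ are determined only up to sign, the signs of the columns of $(\tilde{\mathbf F},\tilde{\mathbf\Lambda})$ are chosen so that, for each $j\le r$, the $j$-th rows of $\tilde{\mathbf F}'\mathbf F^0$ and of $\mathbf Q$ have nonnegative inner product. **Claim.** Under Assumptions A, B and C, for every fixed $t$ and every fixed $i$, as $N,T\to\infty$, $$\sqrt{N^\alpha}\,(\tilde F_t-\mathbf H_{NT,4}'F_t^0)\to_d\mathcal N\big(0,\ \mathbf D_r^{-2}\mathbf Q\Gamma_t\mathbf Q'\mathbf D_r^{-2}\big),$$ $$\sqrt T\,(\tilde\Lambda_i-\mathbf H_{NT,3}^{-1}\Lambda_i^0)\to_d\mathcal N\big(0,\ \mathbf Q'^{-1}\Phi_i\mathbf Q^{-1}\big).$$ (Here an inverse of a singular matrix is read as $0$; this is asymptotically irrelevant.) -/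

import Mathlib

open MeasureTheory ProbabilityTheory Filter Topology Matrix
open scoped MatrixOrder

noncomputable section

namespace WeakFactor

/-- Euclidean norm of a coordinate vector. -/
def vnorm {ι : Type*} [Fintype ι] (v : ι → ℝ) : ℝ := ‖WithLp.toLp 2 v‖

/-- Frobenius norm. -/
def frobNorm {ι κ : Type*} [Fintype ι] [Fintype κ] (A : Matrix ι κ ℝ) : ℝ :=
  Real.sqrt (∑ i, ∑ j, A i j ^ 2)

/-- Spectral norm: the operator norm between Euclidean spaces. -/
def spNorm {ι κ : Type*} [Fintype ι] [Fintype κ] [DecidableEq κ] (A : Matrix ι κ ℝ) : ℝ :=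
  ‖(Matrix.toEuclideanLin A).toContinuousLinearMap‖

/-- `Y k = O_p(a k)` as `k → ∞`, for the scalar sequence `Y` and the deterministic rate `a`. -/
def IsBigOp {Ω : Type*} [MeasurableSpace Ω] (P : Measure Ω) (Y : ℕ → Ω → ℝ) (a : ℕ → ℝ) : Prop :=
  ∀ ε : ℝ, 0 < ε → ∃ C : ℝ, ∀ᶠ k in atTop, P {ω | C * a k < |Y k ω|} ≤ ENNReal.ofReal ε

/-- Convergence in probability of random matrices (of a fixed size) to a deterministic matrix. -/
def TendstoInProb {Ω : Type*} [MeasurableSpace Ω] (P : Measure Ω) {r : ℕ}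
    (A : ℕ → Ω → Matrix (Fin r) (Fin r) ℝ) (B : Matrix (Fin r) (Fin r) ℝ) : Prop :=
  ∀ a b, TendstoInMeasure P (fun k ω => A k ω a b) atTop (fun _ => B a b)

/-- Convergence in distribution to the centred normal law with covariance matrix `S`. -/
def TendstoNormal {Ω : Type*} [MeasurableSpace Ω] (P : Measure Ω) [IsProbabilityMeasure P] {r : ℕ}
    (Y : ℕ → Ω → EuclideanSpace ℝ (Fin r)) (S : Matrix (Fin r) (Fin r) ℝ) : Prop :=
  TendstoInDistribution Y atTop (id : EuclideanSpace ℝ (Fin r) → EuclideanSpace ℝ (Fin r))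
    (fun _ => P) (multivariateGaussian 0 S)

/-- The `n × r` matrix whose `j`-th row is the vector `f j`, `j < n`. -/
def rows {r : ℕ} (n : ℕ) (f : ℕ → EuclideanSpace ℝ (Fin r)) : Matrix (Fin n) (Fin r) ℝ :=
  Matrix.of fun j a => f j a

/-- The random objects of an `r`-factor model: factors `F t`, loadings `Λ N i` (allowed to depend on
the cross-section size `N`, as when loadings shrink with `N`), and errors `e i t`. -/
structure FactorModel (Ω : Type*) [MeasurableSpace Ω] (r : ℕ) where
  F : ℕ → Ω → EuclideanSpace ℝ (Fin r)
  Λ : ℕ → ℕ → Ω → EuclideanSpace ℝ (Fin r)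
  e : ℕ → ℕ → Ω → ℝ
  measurable_F : ∀ t, Measurable (F t)
  measurable_Λ : ∀ N i, Measurable (Λ N i)
  measurable_e : ∀ i t, Measurable (e i t)

namespace FactorModel

variable {Ω : Type*} [MeasurableSpace Ω] {r : ℕ}

/-- The `T × r` matrix of factors. -/
def Fmat (m : FactorModel Ω r) (T : ℕ) (ω : Ω) : Matrix (Fin T) (Fin r) ℝ :=
  rows T fun t => m.F t ω

/-- The `N × r` matrix of loadings. -/
def Λmat (m : FactorModel Ω r) (N : ℕ) (ω : Ω) : Matrix (Fin N) (Fin r) ℝ :=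
  rows N fun i => m.Λ N i ω

/-- The `T × N` matrix of errors. -/
def emat (m : FactorModel Ω r) (N T : ℕ) (ω : Ω) : Matrix (Fin T) (Fin N) ℝ :=
  Matrix.of fun t i => m.e i t ω

/-- The errors of period `t`, a vector of length `N`. -/
def eTime (m : FactorModel Ω r) (N t : ℕ) (ω : Ω) : Fin N → ℝ := fun i => m.e i t ω

/-- The errors of unit `i`, a vector of length `T`. -/
def eUnit (m : FactorModel Ω r) (T i : ℕ) (ω : Ω) : Fin T → ℝ := fun t => m.e i t ω

/-- The `T × N` data matrix `X = F Λ' + e`. -/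
def X (m : FactorModel Ω r) (N T : ℕ) (ω : Ω) : Matrix (Fin T) (Fin N) ℝ :=
  m.Fmat T ω * (m.Λmat N ω)ᵀ + m.emat N T ω

end FactorModel

/-- `min (√N) (√T)`. -/
def δ (N T : ℕ) : ℝ := min (Real.sqrt N) (Real.sqrt T)

section Assumptions

variable {Ω : Type*} [MeasurableSpace Ω] {r : ℕ}

/-- Mean independence and weak dependence of the errors, along the sizes `(N k, T k)`. -/
structure AssumptionA1 (P : Measure Ω) (m : FactorModel Ω r) (N T : ℕ → ℕ) (M : ℝ) : Prop where
  sq_integrable : ∀ i t, MemLp (m.e i t) 2 P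
  mean_indep : ∀ k, ∀ i < N k, ∀ t < T k,
    P[m.e i t | MeasurableSpace.comap (fun ω => (m.Λ (N k) i ω, m.F t ω)) inferInstance] =ᵐ[P] 0
  cross_moment : ∀ k, ∀ t < T k, ∀ s < T k,
    ∫⁻ ω, ENNReal.ofReal ((1 / Real.sqrt (N k) * ∑ i ∈ Finset.range (N k),
      (m.e i t ω * m.e i s ω - ∫ ω', m.e i t ω' * m.e i s ω' ∂P)) ^ 2) ∂P ≤ ENNReal.ofReal M
  weak_serial : ∀ k, ∀ i < N k,
    1 / (T k : ℝ) * ∑ t ∈ Finset.range (T k), ∑ s ∈ Finset.range (T k),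
      |∫ ω, m.e i t ω * m.e i s ω ∂P| ≤ M
  weak_cross : ∀ k, ∀ t < T k,
    1 / (N k : ℝ) * ∑ i ∈ Finset.range (N k), ∑ j ∈ Finset.range (N k),
      |∫ ω, m.e i t ω * m.e j t ω ∂P| ≤ M
  row_bound : ∀ t, IsBigOp P
    (fun k ω => 1 / ((N k : ℝ) * Real.sqrt (T k)) *
      vnorm (m.eTime (N k) t ω ᵥ* (m.emat (N k) (T k) ω)ᵀ))
    (fun k => (δ (N k) (T k))⁻¹)
  col_bound : ∀ i, IsBigOp P
    (fun k ω => 1 / ((T k : ℝ) * Real.sqrt (N k)) *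
      vnorm (m.eUnit (T k) i ω ᵥ* m.emat (N k) (T k) ω))
    (fun k => (δ (N k) (T k))⁻¹)
  spectral_bound : IsBigOp P (fun k ω => spNorm (m.emat (N k) (T k) ω) ^ 2)
    (fun k => max (N k : ℝ) (T k : ℝ))

/-- Moments and second-moment limits of factors and loadings; the loadings have strength `α`. -/
structure AssumptionA2 (P : Measure Ω) (m : FactorModel Ω r) (N T : ℕ → ℕ) (M α : ℝ)
    (SF SΛ : Matrix (Fin r) (Fin r) ℝ) : Prop where
  factor_moment : ∀ k, ∀ t < T k, ∫⁻ ω, ENNReal.ofReal (‖m.F t ω‖ ^ 4) ∂P ≤ ENNReal.ofReal M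
  factor_limit : TendstoInProb P
    (fun k ω => (1 / (T k : ℝ)) • ((m.Fmat (T k) ω)ᵀ * m.Fmat (T k) ω)) SF
  factor_posDef : SF.PosDef
  loading_bound : ∀ k, ∀ i < N k, ∀ᵐ ω ∂P, ‖m.Λ (N k) i ω‖ ≤ M
  strength_pos : 0 < α
  strength_le_one : α ≤ 1
  loading_limit : TendstoInProb P
    (fun k ω => (1 / (N k : ℝ) ^ α) • ((m.Λmat (N k) ω)ᵀ * m.Λmat (N k) ω)) SΛ
  loading_posDef : SΛ.PosDef
  distinct : (SΛ * SF).charpoly.roots.Nodup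

/-- Further moment and rate conditions. -/
structure AssumptionA3 (P : Measure Ω) (m : FactorModel Ω r) (N T : ℕ → ℕ) (M α : ℝ) : Prop where
  loading_error : ∀ k, ∀ t < T k,
    ∫⁻ ω, ENNReal.ofReal (‖(N k : ℝ) ^ (-α / 2) • ∑ i ∈ Finset.range (N k),
      m.e i t ω • m.Λ (N k) i ω‖ ^ 2) ∂P ≤ ENNReal.ofReal M
  row_factor : ∀ t, IsBigOp P
    (fun k ω => 1 / ((N k : ℝ) * T k) *
      vnorm ((m.eTime (N k) t ω ᵥ* (m.emat (N k) (T k) ω)ᵀ) ᵥ* m.Fmat (T k) ω))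
    (fun k => (δ (N k) (T k) ^ 2)⁻¹)
  factor_error : ∀ k, ∀ i < N k,
    ∫⁻ ω, ENNReal.ofReal (‖(1 / Real.sqrt (T k)) • ∑ t ∈ Finset.range (T k),
      m.e i t ω • m.F t ω‖ ^ 2) ∂P ≤ ENNReal.ofReal M
  col_loading : ∀ i, IsBigOp P
    (fun k ω => 1 / ((N k : ℝ) ^ α * T k) *
      vnorm ((m.eUnit (T k) i ω ᵥ* m.emat (N k) (T k) ω) ᵥ* m.Λmat (N k) ω))
    (fun k => 1 / (N k : ℝ) ^ α + 1 / Real.sqrt (T k * (N k : ℝ) ^ α))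
  loading_factor : IsBigOp P
    (fun k ω => frobNorm ((m.Λmat (N k) ω)ᵀ * (m.emat (N k) (T k) ω)ᵀ * m.Fmat (T k) ω))
    (fun k => Real.sqrt ((N k : ℝ) ^ α * T k))

/-- Growth of `T` relative to `N`. -/
def AssumptionA4 (N T : ℕ → ℕ) (α : ℝ) : Prop :=
  Tendsto (fun k => (N k : ℝ) / (N k : ℝ) ^ α * (1 / (T k : ℝ))) atTop (𝓝 0)

structure AssumptionA (P : Measure Ω) (m : FactorModel Ω r) (N T : ℕ → ℕ) (M α : ℝ)
    (SF SΛ : Matrix (Fin r) (Fin r) ℝ) : Prop where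
  a1 : AssumptionA1 P m N T M
  a2 : AssumptionA2 P m N T M α SF SΛ
  a3 : AssumptionA3 P m N T M α
  a4 : AssumptionA4 N T α

/-- Central limit theorems for the cross-sectional sums at each `t` and the time sums for each `i`,
with positive definite limiting covariance matrices `Γ t` and `Φ i`. -/
structure AssumptionB (P : Measure Ω) [IsProbabilityMeasure P] (m : FactorModel Ω r)
    (N T : ℕ → ℕ) (α : ℝ) (Γ Φ : ℕ → Matrix (Fin r) (Fin r) ℝ) : Prop where
  posDef_Γ : ∀ t, (Γ t).PosDef
  posDef_Φ : ∀ i, (Φ i).PosDef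
  clt_cross : ∀ t, TendstoNormal P
    (fun k ω => (1 / Real.sqrt ((N k : ℝ) ^ α)) • ∑ i ∈ Finset.range (N k),
      m.e i t ω • m.Λ (N k) i ω) (Γ t)
  clt_time : ∀ i, TendstoNormal P
    (fun k ω => (1 / Real.sqrt (T k)) • ∑ t ∈ Finset.range (T k), m.e i t ω • m.F t ω) (Φ i)

end Assumptions

structure AssumptionC (N T : ℕ → ℕ) (α : ℝ) : Prop where
  half_lt : 1 / 2 < α
  rate_T : Tendsto (fun k => Real.sqrt (T k) / (N k : ℝ) ^ α) atTop (𝓝 0)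
  rate_N : Tendsto (fun k => 1 / Real.sqrt (T k) * ((N k : ℝ) / (N k : ℝ) ^ α)) atTop (𝓝 0)
  rate_N' : Tendsto (fun k => 1 / (T k : ℝ) * ((N k : ℝ) ^ (3 / 2 : ℝ) / (N k : ℝ) ^ α)) atTop (𝓝 0)

/-- `Z = U D V'` is a full singular value decomposition: `U`, `V` are orthogonal and `D` is the
rectangular diagonal matrix with diagonal entries `d 0 ≥ d 1 ≥ ⋯ ≥ 0`. -/
structure IsSVD {T N : ℕ} (Z : Matrix (Fin T) (Fin N) ℝ) (U : Matrix (Fin T) (Fin T) ℝ)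
    (d : ℕ → ℝ) (V : Matrix (Fin N) (Fin N) ℝ) : Prop where
  orth_U : Uᵀ * U = 1
  orth_V : Vᵀ * V = 1
  antitone : Antitone d
  nonneg : ∀ j, 0 ≤ d j
  decomp : Z = U * (Matrix.of fun (t : Fin T) (i : Fin N) => if (t : ℕ) = i then d t else 0) * Vᵀ

/-- Principal components estimators of factors and loadings from the `T × N` data matrix `X`:
`F̃ = √T U_r` and `Λ̃ = √N V_r D_r`, where `U_r D_r V_r'` is the part of a singular value
decomposition of `X / √(NT)` that belongs to the `r` largest singular values. -/
def IsPC {T N r : ℕ} (hT : r ≤ T) (hN : r ≤ N) (X : Matrix (Fin T) (Fin N) ℝ)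
    (Ft : Matrix (Fin T) (Fin r) ℝ) (Λt : Matrix (Fin N) (Fin r) ℝ) : Prop :=
  ∃ U d V, IsSVD ((1 / Real.sqrt ((N : ℝ) * T)) • X) U d V ∧
    (∀ t j, Ft t j = Real.sqrt T * U t (Fin.castLE hT j)) ∧
    (∀ i j, Λt i j = Real.sqrt N * (V i (Fin.castLE hN j) * d j))

/-- `(F̃' F)⁻¹ (F̃' F̃)`. -/
def H₃ {T r : ℕ} (Ft F : Matrix (Fin T) (Fin r) ℝ) : Matrix (Fin r) (Fin r) ℝ :=
  (Ftᵀ * F)⁻¹ * (Ftᵀ * Ft)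

/-- `(Λ' Λ̃) (Λ̃' Λ̃)⁻¹`. -/
def H₄ {N r : ℕ} (Λt Λ : Matrix (Fin N) (Fin r) ℝ) : Matrix (Fin r) (Fin r) ℝ :=
  (Λᵀ * Λt) * (Λtᵀ * Λt)⁻¹

/-- `v` lists the eigenvalues of `A` (roots of the characteristic polynomial, which all have to be
real, with multiplicity) in decreasing order. -/
structure IsOrderedEigenvalues {r : ℕ} (A : Matrix (Fin r) (Fin r) ℝ) (v : Fin r → ℝ) : Prop where
  antitone : Antitone v
  roots : A.charpoly.roots = Finset.univ.val.map v

/-- `D_r`: the diagonal matrix of the square roots of the entries of `v`. -/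
def Dmat {r : ℕ} (v : Fin r → ℝ) : Matrix (Fin r) (Fin r) ℝ :=
  Matrix.diagonal fun j => Real.sqrt (v j)

/-- `Υ` is an orthogonal matrix whose columns are eigenvectors of `SΛ^{1/2} SF SΛ^{1/2}`, for the
eigenvalues `v` in the given order. -/
structure IsEigenvectorMatrix {r : ℕ} (SF SΛ : Matrix (Fin r) (Fin r) ℝ) (v : Fin r → ℝ)
    (Υ : Matrix (Fin r) (Fin r) ℝ) : Prop where
  orth : Υᵀ * Υ = 1
  eigen : CFC.sqrt SΛ * SF * CFC.sqrt SΛ * Υ = Υ * Matrix.diagonal v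

/-- `Q = D_r Υ' SΛ^{-1/2}`. -/
def Qmat {r : ℕ} (SΛ : Matrix (Fin r) (Fin r) ℝ) (v : Fin r → ℝ)
    (Υ : Matrix (Fin r) (Fin r) ℝ) : Matrix (Fin r) (Fin r) ℝ :=
  Dmat v * Υᵀ * (CFC.sqrt SΛ)⁻¹

end WeakFactor

end

open WeakFactor

/-!
The principal components satisfy exact identities. Since `X' F̃ = T Λ̃` and `X Λ̃ = F̃ (Λ̃'Λ̃)`, the
estimation errors are
`F̃_t - H₄' F_t = (Λ̃'Λ̃)⁻¹ Λ̃' e_t` with `Λ̃' = (F̃'F/T) Λ' + F̃'e/T`, and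
`Λ̃_i - H₃⁻¹ Λ_i = F̃' e_i / T` with `F̃ = F H₄ + e Λ̃ (Λ̃'Λ̃)⁻¹`.
Multiplied by `√(N ^ α)` and `√T`, each is a convergent random matrix times one of the normalized
sums of Assumption B, plus a remainder in which the error matrix `e` occurs once more
(`PCProps.factor_row`, `PCProps.loading_row`, `PCProps.vnorm_factor_sub_le`). The remainders are
negligible by the moment and rate conditions (the lemmas `isBigOp_*` and the structure `Rates`), and
the limit laws follow from Slutsky's theorem (`TendstoNormal.slutsky`).

What is left is the consistency of `A = F̃'F/T` and of `W = Λ̃'Λ̃/N^α`, whose limits are `Q` and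
`D_r²` (`tendsto_overlap`). Up to negligible terms `A SΛ A' = W` and `SF SΛ A' = A' W`, where `W` is
diagonal with decreasing entries. A Weyl-type inequality for singular values bounds the entries of
`W` away from zero (`PCProps.sqrt_eigenvalue_ge`), which excludes degenerate limits. As the
eigenvalues of `SΛ SF` are distinct, the limiting equations together with the sign convention have
`Q` as their only solution (`eq_of_diagonalize`), and by compactness approximate solutions converge
to it (`tendsto_of_diagonalize`).

Throughout, `F` is divided by `√T`, `Λ` by `√(N ^ α)` and `e` by `√(N ^ α T)`, which removes all
scale factors from the matrix identities. Convergence in probability to a constant is treated as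
convergence along a filter on `ℕ × Ω` (`whp`).
-/

noncomputable section

namespace WeakFactor

/-! ### Norms of vectors and matrices -/

section Norms

variable {ι κ μ : Type*} [Fintype ι] [Fintype κ] [Fintype μ]

lemma vnorm_sq (v : ι → ℝ) : vnorm v ^ 2 = ∑ i, v i ^ 2 := by
  simp [vnorm, EuclideanSpace.real_norm_sq_eq]

lemma vnorm_sq_eq_dotProduct (v : ι → ℝ) : vnorm v ^ 2 = v ⬝ᵥ v := by
  rw [vnorm_sq]; simp [dotProduct, sq]

lemma vnorm_nonneg (v : ι → ℝ) : 0 ≤ vnorm v := norm_nonneg _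

lemma vnorm_add_le (v w : ι → ℝ) : vnorm (v + w) ≤ vnorm v + vnorm w := by
  simpa [vnorm] using norm_add_le (WithLp.toLp 2 v) (WithLp.toLp 2 w)

lemma vnorm_sub_le (v w : ι → ℝ) : vnorm (v - w) ≤ vnorm v + vnorm w := by
  simpa [vnorm] using norm_sub_le (WithLp.toLp 2 v) (WithLp.toLp 2 w)

lemma vnorm_smul (c : ℝ) (v : ι → ℝ) : vnorm (c • v) = |c| * vnorm v := by
  simp [vnorm, norm_smul]

lemma dotProduct_le_vnorm (v w : ι → ℝ) : v ⬝ᵥ w ≤ vnorm v * vnorm w := by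
  have := real_inner_le_norm (WithLp.toLp 2 w) (WithLp.toLp 2 v)
  rw [EuclideanSpace.inner_toLp_toLp] at this
  simpa [vnorm, mul_comm] using this

lemma frobNorm_nonneg (A : Matrix ι κ ℝ) : 0 ≤ frobNorm A := Real.sqrt_nonneg _

lemma frobNorm_sq (A : Matrix ι κ ℝ) : frobNorm A ^ 2 = ∑ i, ∑ j, A i j ^ 2 :=
  Real.sq_sqrt (by positivity)

lemma frobNorm_sq_eq_trace (A : Matrix ι κ ℝ) : frobNorm A ^ 2 = (Aᵀ * A).trace := by
  rw [frobNorm_sq, Finset.sum_comm]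
  simp [trace, mul_apply, sq]

lemma frobNorm_eq_rpow (A : Matrix ι κ ℝ) :
    frobNorm A = (∑ i, ∑ j, ‖A i j‖ ^ (2 : ℝ)) ^ (1 / 2 : ℝ) := by
  simp [frobNorm, Real.sqrt_eq_rpow]

section Frobenius

attribute [local instance] Matrix.frobeniusNormedAddCommGroup Matrix.frobeniusNormedSpace

lemma frobNorm_eq_norm (A : Matrix ι κ ℝ) : frobNorm A = ‖A‖ := by
  rw [frobNorm_eq_rpow, Matrix.frobenius_norm_def]

lemma frobNorm_mul_le (A : Matrix ι κ ℝ) (B : Matrix κ μ ℝ) :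
    frobNorm (A * B) ≤ frobNorm A * frobNorm B := by
  simpa only [frobNorm_eq_norm] using Matrix.frobenius_norm_mul A B

lemma frobNorm_transpose (A : Matrix ι κ ℝ) : frobNorm Aᵀ = frobNorm A := by
  simpa only [frobNorm_eq_norm] using Matrix.frobenius_norm_transpose A

lemma frobNorm_add_le (A B : Matrix ι κ ℝ) : frobNorm (A + B) ≤ frobNorm A + frobNorm B := by
  simpa only [frobNorm_eq_norm] using norm_add_le A B

lemma frobNorm_smul (c : ℝ) (A : Matrix ι κ ℝ) : frobNorm (c • A) = |c| * frobNorm A := by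
  simpa only [frobNorm_eq_norm, Real.norm_eq_abs] using norm_smul c A

lemma vnorm_mulVec_le (A : Matrix ι κ ℝ) (v : κ → ℝ) :
    vnorm (A *ᵥ v) ≤ frobNorm A * vnorm v := by
  have h := Matrix.frobenius_norm_mul A (replicateCol Unit v)
  rw [← Matrix.replicateCol_mulVec, frobenius_norm_replicateCol, frobenius_norm_replicateCol] at h
  rwa [← frobNorm_eq_norm] at h

end Frobenius

lemma abs_entry_le_frobNorm (A : Matrix ι κ ℝ) (i : ι) (j : κ) : |A i j| ≤ frobNorm A := by
  refine abs_le_of_sq_le_sq ?_ (frobNorm_nonneg A)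
  rw [frobNorm_sq]
  calc A i j ^ 2 ≤ ∑ j, A i j ^ 2 :=
        Finset.single_le_sum (f := fun j => A i j ^ 2) (fun _ _ => sq_nonneg _) (Finset.mem_univ j)
    _ ≤ _ := Finset.single_le_sum (f := fun i => ∑ j, A i j ^ 2)
        (fun _ _ => Finset.sum_nonneg fun _ _ => sq_nonneg _) (Finset.mem_univ i)

lemma continuous_frobNorm : Continuous (frobNorm : Matrix ι κ ℝ → ℝ) := by
  unfold frobNorm
  refine Real.continuous_sqrt.comp ?_
  exact continuous_finsetSum _ fun i _ => continuous_finsetSum _ fun j _ =>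
    (continuous_id.matrix_elem i j).pow 2

@[simp] lemma frobNorm_zero : frobNorm (0 : Matrix ι κ ℝ) = 0 := by simp [frobNorm]

lemma tendsto_zero_of_frobNorm {β : Type*} {l : Filter β} {A : β → Matrix ι κ ℝ}
    (h : Tendsto (fun b => frobNorm (A b)) l (𝓝 0)) : Tendsto A l (𝓝 0) := by
  refine tendsto_pi_nhds.2 fun i => tendsto_pi_nhds.2 fun j => ?_
  exact squeeze_zero_norm (fun b => abs_entry_le_frobNorm (A b) i j) h

lemma spNorm_nonneg [DecidableEq κ] (A : Matrix ι κ ℝ) : 0 ≤ spNorm A := norm_nonneg _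

lemma vnorm_mulVec_le_spNorm [DecidableEq κ] (A : Matrix ι κ ℝ) (v : κ → ℝ) :
    vnorm (A *ᵥ v) ≤ spNorm A * vnorm v :=
  (Matrix.toEuclideanLin A).toContinuousLinearMap.le_opNorm (WithLp.toLp 2 v)

lemma spNorm_transpose [DecidableEq ι] [DecidableEq κ] (A : Matrix ι κ ℝ) :
    spNorm Aᵀ = spNorm A := by
  have := Matrix.l2_opNorm_conjTranspose A
  rwa [conjTranspose_eq_transpose_of_trivial] at this

lemma frobNorm_sq_eq_sum_vnorm (B : Matrix κ μ ℝ) :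
    frobNorm B ^ 2 = ∑ j, vnorm (fun i => B i j) ^ 2 := by
  simp_rw [frobNorm_sq, vnorm_sq]; exact Finset.sum_comm

lemma frobNorm_mul_le_spNorm [DecidableEq κ] (A : Matrix ι κ ℝ) (B : Matrix κ μ ℝ) :
    frobNorm (A * B) ≤ spNorm A * frobNorm B := by
  refine le_of_sq_le_sq ?_ (mul_nonneg (spNorm_nonneg A) (frobNorm_nonneg B))
  rw [mul_pow, frobNorm_sq_eq_sum_vnorm, frobNorm_sq_eq_sum_vnorm, Finset.mul_sum]
  refine Finset.sum_le_sum fun j _ => ?_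
  rw [← mul_pow]
  exact pow_le_pow_left₀ (vnorm_nonneg _) (vnorm_mulVec_le_spNorm A fun i => B i j) 2

end Norms

/-! ### Principal components -/

/-- The properties of principal components on which the asymptotic argument rests, with the factors
scaled to have Gram matrix `τ • 1`. The numbers `w j` are the `r` largest eigenvalues of `X X'`,
divided by `τ`; the last property is the extremal characterization of singular values, which serves
to bound `w j` from below. -/
structure PCProps {T N r : ℕ} (τ : ℝ) (X : Matrix (Fin T) (Fin N) ℝ)
    (Ft : Matrix (Fin T) (Fin r) ℝ) (Λt : Matrix (Fin N) (Fin r) ℝ) (w : Fin r → ℝ) : Prop where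
  antitone : Antitone w
  gram_factor : Ftᵀ * Ft = τ • (1 : Matrix (Fin r) (Fin r) ℝ)
  gram_loading : Λtᵀ * Λt = diagonal w
  loading_eq : Xᵀ * Ft = τ • Λt
  factor_eq : X * Λt = Ft * diagonal w
  extremal : ∀ j (x : Fin T → ℝ), (∀ i, i ≠ j → (Ftᵀ *ᵥ x) i = 0) →
    vnorm (Xᵀ *ᵥ x) ^ 2 ≤ τ * w j * vnorm x ^ 2

lemma vnorm_sq_orthogonal_mulVec {n : ℕ} {V : Matrix (Fin n) (Fin n) ℝ} (hV : Vᵀ * V = 1)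
    (x : Fin n → ℝ) : vnorm (V *ᵥ x) ^ 2 = vnorm x ^ 2 := by
  rw [vnorm_sq_eq_dotProduct, vnorm_sq_eq_dotProduct, dotProduct_mulVec, vecMul_mulVec, hV]
  simp

lemma IsPC.props {T N r : ℕ} {hT : r ≤ T} {hN : r ≤ N} {X : Matrix (Fin T) (Fin N) ℝ}
    {Ft : Matrix (Fin T) (Fin r) ℝ} {Λt : Matrix (Fin N) (Fin r) ℝ} (hT0 : 0 < T) (hN0 : 0 < N)
    (h : IsPC hT hN X Ft Λt) : ∃ w, PCProps T X Ft Λt w := by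
  obtain ⟨U, d, V, hs, hF, hL⟩ := h
  have hT' : (0 : ℝ) < T := by exact_mod_cast hT0
  have hN' : (0 : ℝ) < N := by exact_mod_cast hN0
  set c : ℝ := Real.sqrt ((N : ℝ) * T) with hc
  have hc0 : 0 < c := Real.sqrt_pos.2 (by positivity)
  have hcNT : c = Real.sqrt N * Real.sqrt T := Real.sqrt_mul hN'.le _
  have hsN : Real.sqrt N * Real.sqrt N = N := Real.mul_self_sqrt hN'.le
  have hsT : Real.sqrt T * Real.sqrt T = T := Real.mul_self_sqrt hT'.le
  set Δ : Matrix (Fin T) (Fin N) ℝ :=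
    Matrix.of fun (t : Fin T) (i : Fin N) => if (t : ℕ) = i then d t else 0 with hΔ
  have hX : X = c • (U * Δ * Vᵀ) := by
    rw [← hs.decomp, smul_smul, mul_one_div_cancel hc0.ne', one_smul]
  have hUU : ∀ i j, ∑ t, U t i * U t j = if i = j then 1 else 0 := fun i j => by
    simpa [mul_apply, one_apply] using congrFun (congrFun hs.orth_U i) j
  have hVV : ∀ i j, ∑ t, V t i * V t j = if i = j then 1 else 0 := fun i j => by
    simpa [mul_apply, one_apply] using congrFun (congrFun hs.orth_V i) j
  have hXV : X * V = c • (U * Δ) := by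
    rw [hX, smul_mul, Matrix.mul_assoc, hs.orth_V, Matrix.mul_one]
  have hXU : Xᵀ * U = c • (V * Δᵀ) := by
    rw [hX, transpose_smul, transpose_mul, transpose_mul, transpose_transpose, smul_mul,
      Matrix.mul_assoc, Matrix.mul_assoc, hs.orth_U, Matrix.mul_one]
  refine ⟨fun j => N * d j ^ 2, ?_, ?_, ?_, ?_, ?_, ?_⟩
  · intro i j hij
    have := hs.antitone (show (i : ℕ) ≤ j from hij)
    have h0 := hs.nonneg j
    show (N : ℝ) * d j ^ 2 ≤ N * d i ^ 2
    gcongr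
  · ext i j
    simp only [mul_apply, transpose_apply, hF, Matrix.smul_apply, one_apply, smul_eq_mul]
    calc ∑ t, Real.sqrt T * U t (Fin.castLE hT i) * (Real.sqrt T * U t (Fin.castLE hT j))
        = Real.sqrt T * Real.sqrt T * ∑ t, U t (Fin.castLE hT i) * U t (Fin.castLE hT j) := by
          rw [Finset.mul_sum]; exact Finset.sum_congr rfl fun _ _ => by ring
      _ = _ := by rw [hUU, hsT]; simp
  · ext i j
    simp only [mul_apply, transpose_apply, hL]
    calc ∑ t, Real.sqrt N * (V t (Fin.castLE hN i) * d i) *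
          (Real.sqrt N * (V t (Fin.castLE hN j) * d j))
        = Real.sqrt N * Real.sqrt N * (d i * d j) *
            ∑ t, V t (Fin.castLE hN i) * V t (Fin.castLE hN j) := by
          rw [Finset.mul_sum]; exact Finset.sum_congr rfl fun _ _ => by ring
      _ = _ := by
          rw [hVV, hsN, diagonal_apply]
          by_cases hij : i = j
          · subst hij; simp only [if_true]; ring
          · simp [hij]
  · ext i j
    have h1 := congrFun (congrFun hXU i) (Fin.castLE hT j)
    have h2 : (V * Δᵀ) i (Fin.castLE hT j) = V i (Fin.castLE hN j) * d j := by
      rw [mul_apply, Finset.sum_eq_single (Fin.castLE hN j)]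
      · simp [hΔ]
      · intro b _ hb
        have : ¬ (j : ℕ) = b := fun hh => hb (Fin.ext (by simp [hh]))
        simp [hΔ, this]
      · simp
    rw [Matrix.smul_apply, h2] at h1
    simp only [mul_apply, transpose_apply, smul_eq_mul] at h1
    simp only [mul_apply, transpose_apply, hF, Matrix.smul_apply, smul_eq_mul, hL]
    calc ∑ t, X t i * (Real.sqrt T * U t (Fin.castLE hT j))
        = Real.sqrt T * ∑ t, X t i * U t (Fin.castLE hT j) := by
          rw [Finset.mul_sum]; exact Finset.sum_congr rfl fun _ _ => by ring
      _ = _ := by rw [h1, hcNT]; linear_combination (Real.sqrt N * (V i (Fin.castLE hN j) * d j)) * hsT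
  · ext t j
    have h1 := congrFun (congrFun hXV t) (Fin.castLE hN j)
    have h2 : (U * Δ) t (Fin.castLE hN j) = U t (Fin.castLE hT j) * d j := by
      rw [mul_apply, Finset.sum_eq_single (Fin.castLE hT j)]
      · simp [hΔ]
      · intro b _ hb
        have : ¬ (b : ℕ) = j := fun hh => hb (Fin.ext (by simp [hh]))
        simp [hΔ, this]
      · simp
    rw [Matrix.smul_apply, h2] at h1
    simp only [mul_apply, smul_eq_mul] at h1
    rw [mul_diagonal]
    simp only [mul_apply, hF, hL]
    calc ∑ i, X t i * (Real.sqrt N * (V i (Fin.castLE hN j) * d j))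
        = Real.sqrt N * d j * ∑ i, X t i * V i (Fin.castLE hN j) := by
          rw [Finset.mul_sum]; exact Finset.sum_congr rfl fun _ _ => by ring
      _ = _ := by rw [h1, hcNT]; linear_combination (Real.sqrt T * U t (Fin.castLE hT j) * d j ^ 2) * hsN
  · intro j x hx
    have hUt : U * Uᵀ = 1 := mul_eq_one_comm.1 hs.orth_U
    set y := Uᵀ *ᵥ x with hy
    have hyx : vnorm y ^ 2 = vnorm x ^ 2 :=
      vnorm_sq_orthogonal_mulVec (by rw [transpose_transpose, hUt]) x
    have hXx : Xᵀ *ᵥ x = c • (V *ᵥ (Δᵀ *ᵥ y)) := by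
      have hxy : x = U *ᵥ y := by rw [hy, mulVec_mulVec, hUt, one_mulVec]
      conv_lhs => rw [hxy]
      rw [mulVec_mulVec, hXU, smul_mulVec, ← mulVec_mulVec]
    have hy0 : ∀ t : Fin T, (t : ℕ) < j → y t = 0 := by
      intro t ht
      have := hx ⟨t, ht.trans j.2⟩ (fun hh => by rw [← hh] at ht; exact lt_irrefl _ ht)
      have h3 : (Ftᵀ *ᵥ x) ⟨t, ht.trans j.2⟩ = Real.sqrt T * y t := by
        simp only [hy, mulVec, dotProduct, transpose_apply, hF, Finset.mul_sum]
        exact Finset.sum_congr rfl fun s _ => by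
          rw [mul_assoc]; congr 1
      rw [h3] at this
      exact (mul_eq_zero.1 this).resolve_left (Real.sqrt_pos.2 hT').ne'
    have hΔy : ∀ i : Fin N, (Δᵀ *ᵥ y) i ^ 2 =
        ∑ t : Fin T, if (t : ℕ) = i then (d t * y t) ^ 2 else 0 := by
      intro i
      simp only [mulVec, dotProduct, transpose_apply, hΔ, of_apply]
      by_cases hi : (i : ℕ) < T
      · rw [Finset.sum_eq_single ⟨i, hi⟩, Finset.sum_eq_single ⟨i, hi⟩]
        · simp
        · intro b _ hb
          rw [if_neg fun hh => hb (Fin.ext hh)]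
        · simp
        · intro b _ hb
          rw [if_neg fun hh => hb (Fin.ext hh), zero_mul]
        · simp
      · rw [Finset.sum_eq_zero, Finset.sum_eq_zero]
        · simp
        · intro t _; rw [if_neg fun hh : (t : ℕ) = i => hi (hh ▸ t.2)]
        · intro t _; rw [if_neg fun hh : (t : ℕ) = i => hi (hh ▸ t.2), zero_mul]
    have hbound : vnorm (Δᵀ *ᵥ y) ^ 2 ≤ d j ^ 2 * vnorm y ^ 2 := by
      rw [vnorm_sq, vnorm_sq, Finset.mul_sum]
      simp_rw [hΔy]
      rw [Finset.sum_comm]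
      refine Finset.sum_le_sum fun t _ => ?_
      have h4 : (d t * y t) ^ 2 ≤ d j ^ 2 * y t ^ 2 := by
        rw [mul_pow]
        by_cases htj : (t : ℕ) < j
        · simp [hy0 t htj]
        · have := hs.antitone (not_lt.1 htj)
          have h0 := hs.nonneg t
          gcongr
      refine le_trans ?_ h4
      by_cases ht : (t : ℕ) < N
      · rw [Finset.sum_eq_single ⟨t, ht⟩]
        · simp
        · intro b _ hb
          rw [if_neg fun hh => hb (Fin.ext hh.symm)]
        · simp
      · rw [Finset.sum_eq_zero]
        · positivity
        · intro i _; rw [if_neg fun hh : (t : ℕ) = i => ht (hh ▸ i.2)]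
    rw [hXx, vnorm_smul, mul_pow, sq_abs, vnorm_sq_orthogonal_mulVec hs.orth_V, ← hyx]
    have hc2 : c ^ 2 = N * T := Real.sq_sqrt (by positivity)
    rw [hc2]
    calc (N : ℝ) * T * vnorm (Δᵀ *ᵥ y) ^ 2 ≤ N * T * (d j ^ 2 * vnorm y ^ 2) := by gcongr
      _ = _ := by ring

/-- Rescaling the data so that the factors become orthonormal and the common component is of
order one. -/
lemma PCProps.normalize {T N r : ℕ} {τ a : ℝ} (hτ : 0 < τ) (ha : 0 < a)
    {X : Matrix (Fin T) (Fin N) ℝ} {Ft : Matrix (Fin T) (Fin r) ℝ}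
    {Λt : Matrix (Fin N) (Fin r) ℝ} {w : Fin r → ℝ} (h : PCProps τ X Ft Λt w) :
    PCProps 1 (((Real.sqrt a)⁻¹ * (Real.sqrt τ)⁻¹) • X) ((Real.sqrt τ)⁻¹ • Ft)
      ((Real.sqrt a)⁻¹ • Λt) (a⁻¹ • w) := by
  have hτ2 : (Real.sqrt τ)⁻¹ * (Real.sqrt τ)⁻¹ = τ⁻¹ := by
    rw [← mul_inv, Real.mul_self_sqrt hτ.le]
  have ha2 : (Real.sqrt a)⁻¹ * (Real.sqrt a)⁻¹ = a⁻¹ := by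
    rw [← mul_inv, Real.mul_self_sqrt ha.le]
  have hs : (Real.sqrt τ)⁻¹ ≠ 0 := (inv_pos.2 (Real.sqrt_pos.2 hτ)).ne'
  refine ⟨fun i j hij => ?_, ?_, ?_, ?_, ?_, ?_⟩
  · exact mul_le_mul_of_nonneg_left (h.antitone hij) (inv_nonneg.2 ha.le)
  · rw [transpose_smul, Matrix.smul_mul, Matrix.mul_smul, smul_smul, hτ2, h.gram_factor, smul_smul,
      inv_mul_cancel₀ hτ.ne']
  · rw [transpose_smul, Matrix.smul_mul, Matrix.mul_smul, smul_smul, ha2, h.gram_loading, diagonal_smul]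
  · rw [transpose_smul, Matrix.smul_mul, Matrix.mul_smul, smul_smul, h.loading_eq, smul_smul, one_smul,
      mul_assoc _ _ (Real.sqrt τ)⁻¹, hτ2, mul_assoc, inv_mul_cancel₀ hτ.ne', mul_one]
  · rw [smul_mul, Matrix.mul_smul, smul_smul, h.factor_eq, diagonal_smul, Matrix.smul_mul, Matrix.mul_smul, smul_smul,
      ← ha2]
    congr 1; ring
  · intro j x hx
    have hx' : ∀ i, i ≠ j → (Ftᵀ *ᵥ x) i = 0 := fun i hi => by
      have := hx i hi
      rw [transpose_smul, smul_mulVec, Pi.smul_apply, smul_eq_mul] at this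
      exact (mul_eq_zero.1 this).resolve_left hs
    have h1 := h.extremal j x hx'
    rw [transpose_smul, smul_mulVec, vnorm_smul, mul_pow, sq_abs, mul_pow, sq, ha2, sq, hτ2]
    calc a⁻¹ * τ⁻¹ * vnorm (Xᵀ *ᵥ x) ^ 2 ≤ a⁻¹ * τ⁻¹ * (τ * w j * vnorm x ^ 2) := by gcongr
      _ = _ := by
        simp only [Pi.smul_apply, smul_eq_mul, one_mul]
        field_simp

/-! ### Perturbation bounds for orthonormal principal components -/

section Deterministic

variable {T N r : ℕ} {F Ft : Matrix (Fin T) (Fin r) ℝ} {L Lt : Matrix (Fin N) (Fin r) ℝ}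
  {E : Matrix (Fin T) (Fin N) ℝ} {w : Fin r → ℝ}

lemma PCProps.frobNorm_factor {X : Matrix (Fin T) (Fin N) ℝ} (h : PCProps 1 X Ft Lt w) :
    frobNorm Ft = Real.sqrt r := by
  rw [← Real.sqrt_sq (frobNorm_nonneg Ft), frobNorm_sq_eq_trace, h.gram_factor]
  simp

lemma PCProps.frobNorm_overlap {X : Matrix (Fin T) (Fin N) ℝ} (h : PCProps 1 X Ft Lt w) :
    frobNorm (Ftᵀ * F) ≤ Real.sqrt r * frobNorm F := by
  refine (frobNorm_mul_le _ _).trans_eq ?_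
  rw [frobNorm_transpose, h.frobNorm_factor]

lemma PCProps.loading_decomp (h : PCProps 1 (F * Lᵀ + E) Ft Lt w) :
    Lt = L * (Ftᵀ * F)ᵀ + Eᵀ * Ft := by
  have := h.loading_eq
  rw [one_smul] at this
  rw [← this]
  simp only [transpose_add, transpose_mul, transpose_transpose, Matrix.add_mul, Matrix.mul_assoc]

/-- The Gram matrix of the estimated loadings is that of the true ones, up to the overlap `F̃'F` and
an error. -/
lemma PCProps.frobNorm_gram_sub_le (h : PCProps 1 (F * Lᵀ + E) Ft Lt w) :
    frobNorm ((Ftᵀ * F) * (Lᵀ * L) * (Ftᵀ * F)ᵀ - diagonal w) ≤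
      2 * (frobNorm (Ftᵀ * F) * frobNorm (E * L) * Real.sqrt r) +
        (Real.sqrt r * spNorm E) ^ 2 := by
  set A := Ftᵀ * F with hA
  have hf := h.frobNorm_factor
  have hkey : diagonal w - A * (Lᵀ * L) * Aᵀ =
      A * (E * L)ᵀ * Ft + (A * (E * L)ᵀ * Ft)ᵀ + (Eᵀ * Ft)ᵀ * (Eᵀ * Ft) := by
    rw [← h.gram_loading, h.loading_decomp, ← hA]
    simp only [transpose_add, transpose_mul, transpose_transpose, Matrix.add_mul, Matrix.mul_add,
      Matrix.mul_assoc]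
    abel
  have h1 : frobNorm (A * (E * L)ᵀ * Ft) ≤ frobNorm A * frobNorm (E * L) * Real.sqrt r := by
    refine (frobNorm_mul_le _ _).trans ?_
    rw [hf]
    gcongr
    exact (frobNorm_mul_le _ _).trans_eq (by rw [frobNorm_transpose])
  have h2 : frobNorm ((Eᵀ * Ft)ᵀ * (Eᵀ * Ft)) ≤ (Real.sqrt r * spNorm E) ^ 2 := by
    refine (frobNorm_mul_le _ _).trans ?_
    have h3 := frobNorm_mul_le_spNorm Eᵀ Ft
    rw [spNorm_transpose, hf, mul_comm] at h3
    rw [frobNorm_transpose, ← sq]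
    exact pow_le_pow_left₀ (frobNorm_nonneg _) h3 2
  rw [← neg_sub, ← neg_one_smul ℝ, frobNorm_smul, hkey]
  simp only [abs_neg, abs_one, one_mul]
  refine (frobNorm_add_le _ _).trans (add_le_add ((frobNorm_add_le _ _).trans ?_) h2)
  rw [frobNorm_transpose]
  linarith

/-- The approximate eigenvalue equation for the overlap `F̃'F`. -/
lemma PCProps.frobNorm_eigen_sub_le (h : PCProps 1 (F * Lᵀ + E) Ft Lt w) :
    frobNorm ((Fᵀ * F) * (Lᵀ * L) * (Ftᵀ * F)ᵀ - (Ftᵀ * F)ᵀ * diagonal w) ≤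
      frobNorm F * frobNorm F * frobNorm (E * L) * Real.sqrt r +
        frobNorm F * frobNorm (E * L) * frobNorm (Ftᵀ * F) +
        frobNorm F * (spNorm E * (spNorm E * Real.sqrt r)) := by
  set A := Ftᵀ * F with hA
  have hf := h.frobNorm_factor
  have hkey : Aᵀ * diagonal w - (Fᵀ * F) * (Lᵀ * L) * Aᵀ =
      Fᵀ * F * (E * L)ᵀ * Ft + Fᵀ * (E * L) * Aᵀ + Fᵀ * (E * (Eᵀ * Ft)) := by
    rw [hA, transpose_mul, transpose_transpose, Matrix.mul_assoc, ← h.factor_eq, h.loading_decomp]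
    simp only [transpose_mul, transpose_transpose, Matrix.add_mul, Matrix.mul_add,
      Matrix.mul_assoc]
    abel
  have h1 : frobNorm (Fᵀ * F * (E * L)ᵀ * Ft) ≤
      frobNorm F * frobNorm F * frobNorm (E * L) * Real.sqrt r := by
    refine (frobNorm_mul_le _ _).trans ?_
    rw [hf]
    gcongr
    refine (frobNorm_mul_le _ _).trans ?_
    rw [frobNorm_transpose (E * L)]
    refine mul_le_mul_of_nonneg_right ?_ (frobNorm_nonneg _)
    exact (frobNorm_mul_le _ _).trans_eq (by rw [frobNorm_transpose])
  have h2 : frobNorm (Fᵀ * (E * L) * Aᵀ) ≤ frobNorm F * frobNorm (E * L) * frobNorm A := by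
    refine (frobNorm_mul_le _ _).trans ?_
    rw [frobNorm_transpose A]
    refine mul_le_mul_of_nonneg_right ?_ (frobNorm_nonneg _)
    exact (frobNorm_mul_le _ _).trans_eq (by rw [frobNorm_transpose])
  have h3 : frobNorm (Fᵀ * (E * (Eᵀ * Ft))) ≤
      frobNorm F * (spNorm E * (spNorm E * Real.sqrt r)) := by
    refine (frobNorm_mul_le _ _).trans ?_
    rw [frobNorm_transpose]
    refine mul_le_mul_of_nonneg_left ?_ (frobNorm_nonneg _)
    refine (frobNorm_mul_le_spNorm _ _).trans (mul_le_mul_of_nonneg_left ?_ (spNorm_nonneg _))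
    refine (frobNorm_mul_le_spNorm _ _).trans_eq ?_
    rw [spNorm_transpose, hf]
  rw [← neg_sub, ← neg_one_smul ℝ, frobNorm_smul, hkey]
  simp only [abs_neg, abs_one, one_mul]
  exact (frobNorm_add_le _ _).trans (add_le_add ((frobNorm_add_le _ _).trans (add_le_add h1 h2)) h3)

lemma PCProps.frobNorm_cross_sub_le (h : PCProps 1 (F * Lᵀ + E) Ft Lt w) :
    frobNorm (Lᵀ * Lt - (Lᵀ * L) * (Ftᵀ * F)ᵀ) ≤ frobNorm (E * L) * Real.sqrt r := by
  have hkey : Lᵀ * Lt - (Lᵀ * L) * (Ftᵀ * F)ᵀ = (E * L)ᵀ * Ft := by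
    nth_rw 1 [h.loading_decomp]
    simp only [transpose_mul, transpose_transpose, Matrix.mul_add, Matrix.mul_assoc]
    abel
  rw [hkey, ← h.frobNorm_factor, ← frobNorm_transpose (E * L)]
  exact frobNorm_mul_le _ _

/-- A Weyl-type lower bound: the leading singular values of `F L' + E` cannot be much smaller than
those of `F L'`. The test vector is `F c`, with `c ≠ 0` chosen so that `F c` is orthogonal to all
estimated factors but the `j`-th. -/
lemma PCProps.sqrt_eigenvalue_ge (h : PCProps 1 (F * Lᵀ + E) Ft Lt w) {cF cL : ℝ} (hcF : 0 ≤ cF)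
    (hcL : 0 ≤ cL) (hF : ∀ c, cF * vnorm c ≤ vnorm (F *ᵥ c))
    (hL : ∀ c, cL * vnorm c ≤ vnorm (L *ᵥ c)) (j : Fin r) :
    cF * cL - spNorm E ≤ Real.sqrt (w j) := by
  obtain ⟨c, hc0, hc⟩ : ∃ c : Fin r → ℝ, c ≠ 0 ∧ (updateRow (Ftᵀ * F) j 0) *ᵥ c = 0 := by
    rw [exists_mulVec_eq_zero_iff]
    exact det_eq_zero_of_row_eq_zero j fun i => by simp
  have hcj : ∀ i, i ≠ j → (Ftᵀ *ᵥ (F *ᵥ c)) i = 0 := fun i hi => by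
    have := congrFun hc i
    rw [mulVec_mulVec]
    simpa [mulVec, updateRow_ne hi] using this
  set x := F *ᵥ c with hx
  have hx0 := vnorm_nonneg x
  have hsw := Real.sqrt_nonneg (w j)
  rcases eq_or_lt_of_le hx0 with hx1 | hx1
  · have hcpos : 0 < vnorm c := by
      refine norm_pos_iff.2 fun h0 => hc0 ?_
      simpa using h0
    have : cF = 0 := by
      have := hF c
      rw [← hx, ← hx1] at this
      nlinarith
    rw [this, zero_mul, zero_sub]
    linarith [spNorm_nonneg E]
  · have hup : vnorm ((F * Lᵀ + E)ᵀ *ᵥ x) ≤ Real.sqrt (w j) * vnorm x := by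
      have h1 := Real.sqrt_le_sqrt (h.extremal j x hcj)
      rwa [one_mul, Real.sqrt_sq (vnorm_nonneg _), Real.sqrt_mul' _ (sq_nonneg _),
        Real.sqrt_sq hx0] at h1
    have hdec : L *ᵥ (Fᵀ *ᵥ x) = (F * Lᵀ + E)ᵀ *ᵥ x - Eᵀ *ᵥ x := by
      rw [transpose_add, add_mulVec, add_sub_cancel_right, transpose_mul, transpose_transpose,
        mulVec_mulVec]
    have h2 : vnorm (L *ᵥ (Fᵀ *ᵥ x)) ≤ Real.sqrt (w j) * vnorm x + spNorm E * vnorm x := by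
      rw [hdec]
      refine (vnorm_sub_le _ _).trans (add_le_add hup ?_)
      rw [← spNorm_transpose]
      exact vnorm_mulVec_le_spNorm _ _
    have h3 := hL (Fᵀ *ᵥ x)
    have h4 : vnorm x ^ 2 ≤ vnorm c * vnorm (Fᵀ *ᵥ x) := by
      rw [vnorm_sq_eq_dotProduct]
      nth_rw 2 [hx]
      rw [dotProduct_mulVec, dotProduct_comm, ← mulVec_transpose]
      exact dotProduct_le_vnorm _ _
    have h5 : cF * vnorm x ≤ vnorm (Fᵀ *ᵥ x) := by
      have h6 := hF c
      rw [← hx] at h6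
      have h7 : cF * vnorm x * vnorm x ≤ vnorm (Fᵀ *ᵥ x) * vnorm x := by
        have := vnorm_nonneg (Fᵀ *ᵥ x)
        nlinarith [mul_le_mul_of_nonneg_left h4 hcF, mul_le_mul_of_nonneg_right h6 this]
      exact le_of_mul_le_mul_right h7 hx1
    have h8 := mul_le_mul_of_nonneg_left h5 hcL
    refine le_of_mul_le_mul_right ?_ hx1
    nlinarith

lemma diagonal_mul_inv {w : Fin r → ℝ} (hw : ∀ j, w j ≠ 0) :
    diagonal w * diagonal w⁻¹ = 1 := by
  rw [diagonal_mul_diagonal, ← diagonal_one]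
  congr 1
  ext j
  simp [hw j]

/-- The estimated factors, projected on a vector `u`: they act like the rotated true factors, up to
terms in which the error matrix appears at least once. -/
lemma PCProps.vnorm_factor_sub_le (h : PCProps 1 (F * Lᵀ + E) Ft Lt w) (hw : ∀ j, w j ≠ 0)
    (u : Fin T → ℝ) :
    vnorm (Ftᵀ *ᵥ u - (Lᵀ * Lt * diagonal w⁻¹)ᵀ *ᵥ (Fᵀ *ᵥ u)) ≤
      frobNorm (diagonal w⁻¹) * (frobNorm (Ftᵀ * F) * vnorm (Lᵀ *ᵥ (Eᵀ *ᵥ u)) +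
        Real.sqrt r * (spNorm E * vnorm (Eᵀ *ᵥ u))) := by
  have hFt : Ft = F * (Lᵀ * Lt * diagonal w⁻¹) + E * Lt * diagonal w⁻¹ := by
    calc Ft = Ft * diagonal w * diagonal w⁻¹ := by
          rw [Matrix.mul_assoc, diagonal_mul_inv hw, Matrix.mul_one]
      _ = _ := by
          rw [← h.factor_eq]
          simp only [Matrix.add_mul, Matrix.mul_assoc]
  have hkey : Ftᵀ *ᵥ u - (Lᵀ * Lt * diagonal w⁻¹)ᵀ *ᵥ (Fᵀ *ᵥ u) =
      diagonal w⁻¹ *ᵥ ((Ftᵀ * F) *ᵥ (Lᵀ *ᵥ (Eᵀ *ᵥ u)) + Ftᵀ *ᵥ (E *ᵥ (Eᵀ *ᵥ u))) := by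
    have h1 : Ltᵀ = Ftᵀ * F * Lᵀ + Ftᵀ * E := by
      conv_lhs => rw [h.loading_decomp]
      simp only [transpose_add, transpose_mul, transpose_transpose]
    nth_rw 1 [hFt]
    rw [transpose_add, add_mulVec, transpose_mul, ← mulVec_mulVec, add_sub_cancel_left,
      transpose_mul, transpose_mul, diagonal_transpose, h1]
    simp only [Matrix.add_mul, Matrix.mul_add, add_mulVec, mulVec_add, mulVec_mulVec,
      Matrix.mul_assoc]
  rw [hkey]
  refine (vnorm_mulVec_le _ _).trans (mul_le_mul_of_nonneg_left ?_ (frobNorm_nonneg _))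
  refine (vnorm_add_le _ _).trans (add_le_add (vnorm_mulVec_le _ _) ?_)
  refine (vnorm_mulVec_le _ _).trans ?_
  rw [frobNorm_transpose, h.frobNorm_factor]
  exact mul_le_mul_of_nonneg_left (vnorm_mulVec_le_spNorm _ _) (Real.sqrt_nonneg _)

lemma PCProps.factor_row (h : PCProps 1 (F * Lᵀ + E) Ft Lt w) (hw : ∀ j, w j ≠ 0) (t : Fin T) :
    Ft t - (Lᵀ * Lt * diagonal w⁻¹)ᵀ *ᵥ F t =
      diagonal w⁻¹ *ᵥ ((Ftᵀ * F) *ᵥ (Lᵀ *ᵥ E t) + Ftᵀ *ᵥ (E *ᵥ E t)) := by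
  have h1 : Ltᵀ = Ftᵀ * F * Lᵀ + Ftᵀ * E := by
    conv_lhs => rw [h.loading_decomp]
    simp only [transpose_add, transpose_mul, transpose_transpose]
  have hX : (F * Lᵀ + E) t = L *ᵥ F t + E t := by
    ext i
    simp [mul_apply, mulVec, dotProduct, mul_comm]
  have h2 : diagonal w⁻¹ *ᵥ (Ltᵀ *ᵥ (F * Lᵀ + E) t) = Ft t := by
    have h3 : Ltᵀ *ᵥ (F * Lᵀ + E) t = diagonal w *ᵥ Ft t := by
      ext j
      have := congrFun (congrFun h.factor_eq t) j
      rw [mul_diagonal, mul_apply] at this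
      rw [mulVec_diagonal, mul_comm, ← this]
      simp [mulVec, dotProduct, mul_comm]
    rw [h3, mulVec_mulVec, diagonal_mul_diagonal, ← diagonal_mul_diagonal,
      mul_eq_one_comm.1 (diagonal_mul_inv hw), one_mulVec]
  rw [← h2, hX, transpose_mul, transpose_mul, diagonal_transpose, transpose_transpose, h1]
  simp only [Matrix.add_mul, Matrix.mul_add, add_mulVec, mulVec_add, mulVec_mulVec,
      Matrix.mul_assoc]
  abel

lemma PCProps.loading_row (h : PCProps 1 (F * Lᵀ + E) Ft Lt w) (i : Fin N) :
    Lt i - (Ftᵀ * F) *ᵥ L i = Ftᵀ *ᵥ Eᵀ i := by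
  have h1 : Lt i = (Ftᵀ * F) *ᵥ L i + Ftᵀ *ᵥ Eᵀ i := by
    conv_lhs => rw [h.loading_decomp]
    ext j
    simp [mul_apply, mulVec, dotProduct, mul_comm]
  rw [h1, add_sub_cancel_left]

end Deterministic

/-! ### The limit of the overlap matrix -/

section Limit

variable {r : ℕ}

lemma eq_of_antitone_of_map_eq {v w : Fin r → ℝ} (hv : Antitone v) (hw : Antitone w)
    (h : Finset.univ.val.map v = Finset.univ.val.map w) : v = w := by
  rw [Fin.univ_val_map, Fin.univ_val_map, Multiset.coe_eq_coe] at h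
  exact List.ofFn_injective
    (h.eq_of_pairwise' hv.sortedGE_ofFn.pairwise hw.sortedGE_ofFn.pairwise)

lemma roots_charpoly_diagonal (w : Fin r → ℝ) :
    (diagonal w).charpoly.roots = Finset.univ.val.map w := by
  rw [charpoly_diagonal, Polynomial.roots_prod _ _ (by
    simp [Finset.prod_ne_zero_iff, Polynomial.X_sub_C_ne_zero])]
  simp

/-- The rotation `Q` normalized by `Q S Q' = diag v` whose transpose diagonalizes `K`, with distinct
eigenvalues in decreasing order, is unique once the signs of its rows are fixed. -/
lemma eq_of_diagonalize {K S A Q : Matrix (Fin r) (Fin r) ℝ} {v w : Fin r → ℝ}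
    (hA : K * Aᵀ = Aᵀ * diagonal w) (hAS : A * S * Aᵀ = diagonal w)
    (hQ : K * Qᵀ = Qᵀ * diagonal v) (hQS : Q * S * Qᵀ = diagonal v)
    (hw : Antitone w) (hw0 : ∀ j, 0 < w j) (hv : Antitone v) (hv0 : ∀ j, 0 < v j)
    (hvi : Function.Injective v) (hsign : ∀ j, 0 ≤ (A * Qᵀ) j j) : A = Q ∧ w = v := by
  have hunit : ∀ {B : Matrix (Fin r) (Fin r) ℝ} {u : Fin r → ℝ}, B * S * Bᵀ = diagonal u →
      (∀ j, 0 < u j) → IsUnit Bᵀ := by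
    intro B u hB hu
    rw [isUnit_iff_isUnit_det, isUnit_iff_ne_zero]
    intro h0
    have h1 := congrArg det hB
    rw [det_mul, h0, mul_zero, det_diagonal] at h1
    exact (Finset.prod_pos fun j _ => hu j).ne h1
  have hroots : ∀ {B : Matrix (Fin r) (Fin r) ℝ} {u : Fin r → ℝ}, K * Bᵀ = Bᵀ * diagonal u →
      IsUnit Bᵀ → K.charpoly.roots = Finset.univ.val.map u := by
    rintro B u hB ⟨U, hU⟩
    rw [← hU] at hB
    have hK : K = U.val * diagonal u * U.val⁻¹ := by
      rw [← hB, Matrix.mul_assoc, Matrix.mul_nonsing_inv _ (U.isUnit.map detMonoidHom),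
        Matrix.mul_one]
    rw [hK, charpoly_units_conj, roots_charpoly_diagonal]
  have hAu := hunit hAS hw0
  have hQu := hunit hQS hv0
  have hwv : w = v := eq_of_antitone_of_map_eq hw hv (by rw [← hroots hA hAu, hroots hQ hQu])
  subst hwv
  refine ⟨?_, rfl⟩
  have hQdet : IsUnit (Qᵀ).det := (isUnit_iff_isUnit_det _).1 hQu
  -- The change of basis commutes with a diagonal matrix with distinct entries.
  set R := (Qᵀ)⁻¹ * Aᵀ with hR
  have hAR : Aᵀ = Qᵀ * R := by
    rw [hR, ← Matrix.mul_assoc, mul_nonsing_inv _ hQdet, Matrix.one_mul]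
  have hcomm : diagonal w * R = R * diagonal w := by
    have h1 : Qᵀ * (diagonal w * R) = Qᵀ * (R * diagonal w) := by
      rw [← Matrix.mul_assoc, ← hQ, Matrix.mul_assoc, ← hAR, hA, hAR, Matrix.mul_assoc]
    have h2 := congrArg ((Qᵀ)⁻¹ * ·) h1
    simpa only [← Matrix.mul_assoc, nonsing_inv_mul _ hQdet, Matrix.one_mul] using h2
  have hRdiag : R = diagonal fun j => R j j := by
    ext i j
    by_cases hij : i = j
    · subst hij; simp
    · have h1 := congrFun (congrFun hcomm i) j
      rw [diagonal_mul, mul_diagonal] at h1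
      have h2 : (w i - w j) * R i j = 0 := by linear_combination h1
      rw [diagonal_apply_ne _ hij]
      exact (mul_eq_zero.1 h2).resolve_left (sub_ne_zero.2 fun h => hij (hvi h))
  have hA' : A = R * Q := by
    have := congrArg transpose hAR
    rw [transpose_transpose, transpose_mul, transpose_transpose] at this
    rw [this, hRdiag, diagonal_transpose]
  have hsq : ∀ j, R j j * R j j = 1 := by
    intro j
    have h1 : R * diagonal w * R = diagonal w := by
      calc R * diagonal w * R = R * Q * S * (Qᵀ * R) := by
            rw [← hQS]; simp only [Matrix.mul_assoc]
        _ = diagonal w := by rw [← hA', ← hAR, hAS]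
    have h2 := congrFun (congrFun h1 j) j
    rw [hRdiag, diagonal_mul_diagonal, diagonal_mul_diagonal] at h2
    simp only [diagonal_apply_eq] at h2
    have := (hw0 j).ne'
    field_simp at h2 ⊢
    nlinarith
  have hone : ∀ j, R j j = 1 := by
    intro j
    have h1 : (A * Qᵀ) j j = R j j * (Q * Qᵀ) j j := by
      rw [hA', hRdiag, Matrix.mul_assoc, diagonal_mul]
      simp
    have hpos : 0 < (Q * Qᵀ) j j := by
      have h2 : (Q * Qᵀ) j j = ∑ i, Q j i ^ 2 := by simp [mul_apply, sq]
      rw [h2]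
      refine lt_of_le_of_ne (Finset.sum_nonneg fun _ _ => sq_nonneg _) fun h3 => ?_
      have h4 : ∀ i, Q j i = 0 := fun i => by
        have := (Finset.sum_eq_zero_iff_of_nonneg fun i _ => sq_nonneg (Q j i)).1 h3.symm i
          (Finset.mem_univ i)
        exact pow_eq_zero_iff (two_ne_zero) |>.1 this
      have h5 := congrFun (congrFun hQS j) j
      rw [Matrix.mul_assoc, mul_apply, diagonal_apply_eq] at h5
      simp only [h4, zero_mul, Finset.sum_const_zero] at h5
      exact (hw0 j).ne h5
    have h6 : 0 ≤ R j j := by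
      have := hsign j
      rw [h1] at this
      exact nonneg_of_mul_nonneg_left this hpos
    nlinarith [hsq j]
  rw [hA', hRdiag]
  simp [hone]

/-- Approximate solutions of the equations that characterize `Q` converge to `Q`. -/
lemma tendsto_of_diagonalize {β : Type*} {l : Filter β} {K S Q : Matrix (Fin r) (Fin r) ℝ}
    {v : Fin r → ℝ} {A : β → Matrix (Fin r) (Fin r) ℝ} {w : β → Fin r → ℝ} {c C : ℝ}
    (hA : Tendsto (fun b => K * (A b)ᵀ - (A b)ᵀ * diagonal (w b)) l (𝓝 0))
    (hAS : Tendsto (fun b => A b * S * (A b)ᵀ - diagonal (w b)) l (𝓝 0))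
    (hw : ∀ᶠ b in l, Antitone (w b)) (hc : 0 < c) (hwc : ∀ᶠ b in l, ∀ j, c ≤ w b j)
    (hbdd : ∀ᶠ b in l, frobNorm (A b) ≤ C) (hsign : ∀ᶠ b in l, ∀ j, 0 ≤ (A b * Qᵀ) j j)
    (hQ : K * Qᵀ = Qᵀ * diagonal v) (hQS : Q * S * Qᵀ = diagonal v)
    (hv : Antitone v) (hv0 : ∀ j, 0 < v j) (hvi : Function.Injective v) :
    Tendsto A l (𝓝 Q) ∧ Tendsto w l (𝓝 v) := by
  have hcts : Continuous fun B : Matrix (Fin r) (Fin r) ℝ => B * S * Bᵀ :=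
    (continuous_id.matrix_mul continuous_const).matrix_mul continuous_id.matrix_transpose
  have hwlim : ∀ {u : Filter β} {B : Matrix (Fin r) (Fin r) ℝ}, u ≤ l → Tendsto A u (𝓝 B) →
      Tendsto w u (𝓝 fun j => (B * S * Bᵀ) j j) := by
    intro u B hu hB
    have h1 := ((hcts.tendsto B).comp hB).sub (hAS.mono_left hu)
    refine tendsto_pi_nhds.2 fun j => ?_
    have h2 := tendsto_pi_nhds.1 (tendsto_pi_nhds.1 h1 j) j
    simpa using h2
  have hlim : Tendsto A l (𝓝 Q) := by
    rw [tendsto_iff_ultrafilter]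
    intro u hu
    have hK : IsCompact {B : Matrix (Fin r) (Fin r) ℝ |
        ∀ i ∈ Set.univ, ∀ j ∈ Set.univ, B i j ∈ Set.Icc (-C) C} :=
      isCompact_univ_pi fun _ => isCompact_univ_pi fun _ => isCompact_Icc
    obtain ⟨B, hB'⟩ : ∃ B : Matrix (Fin r) (Fin r) ℝ, Tendsto A u (𝓝 B) := by
      obtain ⟨B, -, hB⟩ := hK.ultrafilter_le_nhds' (u.map A) (by
        rw [Ultrafilter.mem_map]
        filter_upwards [hu hbdd] with b hb
        exact fun i _ j _ => abs_le.1 ((abs_entry_le_frobNorm (A b) i j).trans hb))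
      exact ⟨B, hB⟩
    obtain ⟨w', hwB⟩ : ∃ w', Tendsto w u (𝓝 w') := ⟨_, hwlim hu hB'⟩
    have hdiag : Tendsto (fun b => diagonal (w b)) u (𝓝 (diagonal w')) :=
      (continuous_id.matrix_diagonal.tendsto w').comp hwB
    have e1 : K * Bᵀ - Bᵀ * diagonal w' = 0 := by
      refine tendsto_nhds_unique (f := fun b => K * (A b)ᵀ - (A b)ᵀ * diagonal (w b)) (l := u) ?_
        (hA.mono_left hu)
      have hBt : Tendsto (fun b => (A b)ᵀ) u (𝓝 Bᵀ) :=
        (continuous_id.matrix_transpose.tendsto B).comp hB'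
      exact (tendsto_const_nhds.mul hBt).sub (hBt.mul hdiag)
    have e2 : B * S * Bᵀ - diagonal w' = 0 := by
      refine tendsto_nhds_unique (f := fun b => A b * S * (A b)ᵀ - diagonal (w b)) (l := u) ?_
        (hAS.mono_left hu)
      exact ((hcts.tendsto B).comp hB').sub hdiag
    have e3 : Antitone w' := fun i j hij =>
      le_of_tendsto_of_tendsto (tendsto_pi_nhds.1 hwB j) (tendsto_pi_nhds.1 hwB i)
        (by filter_upwards [hu hw] with b hb using hb hij)
    have e4 : ∀ j, 0 < w' j := fun j => hc.trans_le
      (ge_of_tendsto (tendsto_pi_nhds.1 hwB j) (by filter_upwards [hu hwc] with b hb using hb j))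
    have e5 : ∀ j, 0 ≤ (B * Qᵀ) j j := fun j => by
      have h1 : Tendsto (fun b => A b * Qᵀ) u (𝓝 (B * Qᵀ)) := hB'.mul tendsto_const_nhds
      exact ge_of_tendsto (tendsto_pi_nhds.1 (tendsto_pi_nhds.1 h1 j) j)
        (by filter_upwards [hu hsign] with b hb using hb j)
    obtain ⟨rfl, -⟩ := eq_of_diagonalize (sub_eq_zero.1 e1) (sub_eq_zero.1 e2) hQ hQS e3 e4 hv hv0
      hvi e5
    exact hB'
  refine ⟨hlim, ?_⟩
  have := hwlim le_rfl hlim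
  simpa [hQS] using this

section Rotation

variable {SF SΛ Υ : Matrix (Fin r) (Fin r) ℝ} {v : Fin r → ℝ}

lemma sqrt_mul_sqrt_of_posDef (hS : SΛ.PosDef) : CFC.sqrt SΛ * CFC.sqrt SΛ = SΛ :=
  CFC.sqrt_mul_sqrt_self _ hS.posSemidef.nonneg

lemma transpose_sqrt (S : Matrix (Fin r) (Fin r) ℝ) : (CFC.sqrt S)ᵀ = CFC.sqrt S := by
  have := (CFC.sqrt_nonneg S).isSelfAdjoint.star_eq
  rwa [star_eq_conjTranspose, conjTranspose_eq_transpose_of_trivial] at this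

lemma isUnit_det_sqrt (hS : SΛ.PosDef) : IsUnit (CFC.sqrt SΛ).det := by
  have h1 := congrArg det (sqrt_mul_sqrt_of_posDef hS)
  rw [det_mul] at h1
  rw [isUnit_iff_ne_zero]
  intro h0
  rw [h0, mul_zero] at h1
  exact hS.det_pos.ne h1

lemma eigenvalue_pos (hF : SF.PosDef) (hS : SΛ.PosDef) (hΥ : IsEigenvectorMatrix SF SΛ v Υ)
    (j : Fin r) : 0 < v j := by
  have h1 : diagonal v = (CFC.sqrt SΛ * Υ)ᴴ * SF * (CFC.sqrt SΛ * Υ) := by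
    rw [conjTranspose_eq_transpose_of_trivial, transpose_mul, transpose_sqrt]
    calc diagonal v = Υᵀ * (Υ * diagonal v) := by
          rw [← Matrix.mul_assoc, hΥ.orth, Matrix.one_mul]
      _ = _ := by rw [← hΥ.eigen]; simp only [Matrix.mul_assoc]
  have hu : IsUnit (CFC.sqrt SΛ * Υ) := by
    rw [isUnit_iff_isUnit_det, det_mul]
    refine (isUnit_det_sqrt hS).mul ((isUnit_iff_isUnit_det _).1 ?_)
    exact IsUnit.of_mul_eq_one_right _ hΥ.orth
  have h2 : (diagonal v).PosDef := by
    rw [h1]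
    exact hF.conjTranspose_mul_mul_same (mulVec_injective_of_isUnit hu)
  exact posDef_diagonal_iff.1 h2 j

lemma Qmat_gram (hF : SF.PosDef) (hS : SΛ.PosDef) (hΥ : IsEigenvectorMatrix SF SΛ v Υ) :
    Qmat SΛ v Υ * SΛ * (Qmat SΛ v Υ)ᵀ = diagonal v := by
  have hd := isUnit_det_sqrt hS
  have h1 : (CFC.sqrt SΛ)⁻¹ * SΛ * (CFC.sqrt SΛ)⁻¹ = 1 := by
    nth_rw 2 [← sqrt_mul_sqrt_of_posDef hS]
    rw [← Matrix.mul_assoc, nonsing_inv_mul _ hd, Matrix.one_mul, mul_nonsing_inv _ hd]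
  rw [Qmat, Dmat]
  simp only [transpose_mul, transpose_transpose, transpose_nonsing_inv, transpose_sqrt,
    diagonal_transpose]
  calc _ = diagonal (fun j => Real.sqrt (v j)) * Υᵀ * ((CFC.sqrt SΛ)⁻¹ * SΛ * (CFC.sqrt SΛ)⁻¹) *
        Υ * diagonal fun j => Real.sqrt (v j) := by simp only [Matrix.mul_assoc]
    _ = diagonal v := by
      rw [h1, Matrix.mul_one, Matrix.mul_assoc _ Υᵀ, hΥ.orth, Matrix.mul_one, diagonal_mul_diagonal]
      congr 1
      ext j
      exact Real.mul_self_sqrt (eigenvalue_pos hF hS hΥ j).le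

lemma Qmat_eigen (hS : SΛ.PosDef) (hΥ : IsEigenvectorMatrix SF SΛ v Υ) :
    SF * SΛ * (Qmat SΛ v Υ)ᵀ = (Qmat SΛ v Υ)ᵀ * diagonal v := by
  have hd := isUnit_det_sqrt hS
  rw [Qmat, Dmat]
  simp only [transpose_mul, transpose_transpose, transpose_nonsing_inv, transpose_sqrt,
    diagonal_transpose]
  set D := diagonal fun j => Real.sqrt (v j)
  have hcomm : D * diagonal v = diagonal v * D := by
    simp only [D, diagonal_mul_diagonal, mul_comm]
  set R := CFC.sqrt SΛ
  calc SF * SΛ * (R⁻¹ * (Υ * D)) = SF * (R * R) * (R⁻¹ * (Υ * D)) := by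
        rw [sqrt_mul_sqrt_of_posDef hS]
    _ = SF * R * (R * R⁻¹) * Υ * D := by simp only [Matrix.mul_assoc]
    _ = (R⁻¹ * R) * SF * R * Υ * D := by
        rw [mul_nonsing_inv _ hd, nonsing_inv_mul _ hd, Matrix.mul_one, Matrix.one_mul]
    _ = R⁻¹ * (R * SF * R * Υ) * D := by simp only [Matrix.mul_assoc]
    _ = R⁻¹ * (Υ * D) * diagonal v := by
        rw [hΥ.eigen]
        simp only [Matrix.mul_assoc, hcomm]

lemma Dmat_sq (hv0 : ∀ j, 0 < v j) : Dmat v ^ 2 = diagonal v := by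
  rw [Dmat, sq, diagonal_mul_diagonal]
  congr 1
  ext j
  exact Real.mul_self_sqrt (hv0 j).le

lemma IsOrderedEigenvalues.injective {K : Matrix (Fin r) (Fin r) ℝ}
    (hv : IsOrderedEigenvalues K v) (hK : K.charpoly.roots.Nodup) : Function.Injective v := by
  rw [hv.roots] at hK
  exact fun i j hij => Multiset.inj_on_of_nodup_map hK i (Finset.mem_univ_val i) j
    (Finset.mem_univ_val j) hij

end Rotation

end Limit

/-! ### Convergence in probability as convergence along a filter -/

section Probability

variable {Ω : Type*} [MeasurableSpace Ω] {P : Measure Ω}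

/-- The filter on `ℕ × Ω` of the events that hold with probability tending to one. Convergence in
probability to a constant is convergence along this filter, so that all rules for limits along
filters apply to it. -/
def whp (P : Measure Ω) : Filter (ℕ × Ω) where
  sets := {s | Tendsto (fun k => P {ω | (k, ω) ∉ s}) atTop (𝓝 0)}
  univ_sets := by simp
  sets_of_superset {s t} hs hst := by
    refine tendsto_of_tendsto_of_tendsto_of_le_of_le tendsto_const_nhds hs (fun _ => zero_le)
      fun k => measure_mono fun ω hω h => hω (hst h)
  inter_sets {s t} hs ht := by
    have h := Tendsto.add hs ht
    rw [add_zero] at h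
    refine tendsto_of_tendsto_of_tendsto_of_le_of_le tendsto_const_nhds h (fun _ => zero_le)
      fun k => (measure_mono fun ω hω => ?_).trans (measure_union_le _ _)
    by_contra h'
    simp only [Set.mem_union, Set.mem_ofPred_eq, not_or, not_not] at h'
    exact hω h'

lemma eventually_whp_iff {p : ℕ × Ω → Prop} :
    (∀ᶠ x in whp P, p x) ↔ Tendsto (fun k => P {ω | ¬ p (k, ω)}) atTop (𝓝 0) := Iff.rfl

lemma eventually_whp_of_ae {p : ℕ × Ω → Prop} (h : ∀ᶠ k in atTop, ∀ᵐ ω ∂P, p (k, ω)) :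
    ∀ᶠ x in whp P, p x := by
  rw [eventually_whp_iff]
  exact tendsto_const_nhds.congr' (h.mono fun k hk => (ae_iff.1 hk).symm)

lemma tendsto_fst_whp : Tendsto Prod.fst (whp P) atTop := fun s hs => by
  refine eventually_whp_of_ae (p := fun x => x.1 ∈ s) ?_
  filter_upwards [hs] with k hk using Eventually.of_forall fun _ => hk

lemma tendstoInMeasure_const_iff {E : Type*} [PseudoMetricSpace E] {f : ℕ → Ω → E} {c : E} :
    TendstoInMeasure P f atTop (fun _ => c) ↔
      Tendsto (fun x : ℕ × Ω => f x.1 x.2) (whp P) (𝓝 c) := by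
  rw [tendstoInMeasure_iff_dist, Metric.tendsto_nhds]
  simp only [eventually_whp_iff, not_lt]

lemma TendstoInProb.tendsto_whp {r : ℕ} {A : ℕ → Ω → Matrix (Fin r) (Fin r) ℝ}
    {B : Matrix (Fin r) (Fin r) ℝ} (h : TendstoInProb P A B) :
    Tendsto (fun x : ℕ × Ω => A x.1 x.2) (whp P) (𝓝 B) := by
  have h1 : ∀ i j, Tendsto (fun x : ℕ × Ω => A x.1 x.2 i j) (whp P) (𝓝 (B i j)) := fun i j =>
    tendstoInMeasure_const_iff (f := fun k ω => A k ω i j).1 (h i j)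
  exact tendsto_pi_nhds.2 fun i => tendsto_pi_nhds.2 fun j => h1 i j

/-! ### Stochastic boundedness -/

lemma IsBigOp.exists_nonneg {Y : ℕ → Ω → ℝ} {a : ℕ → ℝ} (h : IsBigOp P Y a)
    (ha : ∀ᶠ k in atTop, 0 ≤ a k) {ε : ℝ} (hε : 0 < ε) :
    ∃ C : ℝ, 0 ≤ C ∧ ∀ᶠ k in atTop, P {ω | C * a k < |Y k ω|} ≤ ENNReal.ofReal ε := by
  obtain ⟨C, hC⟩ := h ε hε
  refine ⟨max C 0, le_max_right _ _, ?_⟩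
  filter_upwards [hC, ha] with k hk hak
  refine (measure_mono fun ω hω => ?_).trans hk
  exact lt_of_le_of_lt (mul_le_mul_of_nonneg_right (le_max_left _ _) hak) hω

lemma IsBigOp.mul {Y Z : ℕ → Ω → ℝ} {a b : ℕ → ℝ} (hY : IsBigOp P Y a) (hZ : IsBigOp P Z b)
    (ha : ∀ᶠ k in atTop, 0 ≤ a k) (hb : ∀ᶠ k in atTop, 0 ≤ b k) :
    IsBigOp P (fun k ω => Y k ω * Z k ω) (fun k => a k * b k) := by
  intro ε hε
  obtain ⟨C, hC0, hC⟩ := hY.exists_nonneg ha (half_pos hε)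
  obtain ⟨D, hD0, hD⟩ := hZ.exists_nonneg hb (half_pos hε)
  refine ⟨C * D, ?_⟩
  filter_upwards [hC, hD, ha, hb] with k h1 h2 h3 h4
  have h5 : P {ω | C * D * (a k * b k) < |Y k ω * Z k ω|} ≤
      P ({ω | C * a k < |Y k ω|} ∪ {ω | D * b k < |Z k ω|}) := by
    refine measure_mono fun ω hω => ?_
    by_contra h'
    simp only [Set.mem_union, Set.mem_ofPred_eq, not_or, not_lt] at h' hω
    rw [abs_mul] at hω
    have := mul_le_mul h'.1 h'.2 (abs_nonneg _) (mul_nonneg hC0 h3)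
    linarith
  refine h5.trans ((measure_union_le _ _).trans ((add_le_add h1 h2).trans_eq ?_))
  rw [← ENNReal.ofReal_add (half_pos hε).le (half_pos hε).le, add_halves]

lemma isBigOp_const (b : ℕ → ℝ) : IsBigOp P (fun k _ => b k) (fun k => |b k|) :=
  fun _ _ => ⟨1, Eventually.of_forall fun k => by simp⟩

lemma IsBigOp.const_mul {Y : ℕ → Ω → ℝ} {a : ℕ → ℝ} (hY : IsBigOp P Y a)
    (ha : ∀ᶠ k in atTop, 0 ≤ a k) (b : ℕ → ℝ) :
    IsBigOp P (fun k ω => b k * Y k ω) (fun k => |b k| * a k) :=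
  (isBigOp_const b).mul hY (Eventually.of_forall fun _ => abs_nonneg _) ha

lemma IsBigOp.of_sq {Y : ℕ → Ω → ℝ} {a : ℕ → ℝ} (hY : IsBigOp P (fun k ω => Y k ω ^ 2) a)
    (ha : ∀ᶠ k in atTop, 0 ≤ a k) : IsBigOp P Y (fun k => Real.sqrt (a k)) := by
  intro ε hε
  obtain ⟨C, hC0, hC⟩ := hY.exists_nonneg ha hε
  refine ⟨Real.sqrt C, ?_⟩
  filter_upwards [hC, ha] with k hk hak
  refine (measure_mono fun ω hω => ?_).trans hk
  have h1 : Real.sqrt C * Real.sqrt (a k) < |Y k ω| := hω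
  have h2 := pow_lt_pow_left₀ h1 (by positivity) two_ne_zero
  rw [mul_pow, Real.sq_sqrt hC0, Real.sq_sqrt hak] at h2
  rwa [Set.mem_ofPred_eq, abs_pow]

lemma IsBigOp.tendsto_zero {Y : ℕ → Ω → ℝ} {a : ℕ → ℝ} (hY : IsBigOp P Y a)
    (ha : ∀ᶠ k in atTop, 0 ≤ a k) (ha0 : Tendsto a atTop (𝓝 0)) :
    Tendsto (fun x : ℕ × Ω => Y x.1 x.2) (whp P) (𝓝 0) := by
  rw [Metric.tendsto_nhds]
  intro η hη
  rw [eventually_whp_iff, ENNReal.tendsto_nhds_zero]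
  intro ε hε
  have hε1 : min ε 1 ≠ ⊤ := ne_top_of_le_ne_top ENNReal.one_ne_top (min_le_right _ _)
  have hε0 : 0 < (min ε 1).toReal := ENNReal.toReal_pos (lt_min hε one_pos).ne' hε1
  obtain ⟨C, hC0, hC⟩ := hY.exists_nonneg ha hε0
  have hCa : Tendsto (fun k => C * a k) atTop (𝓝 0) := by simpa using ha0.const_mul C
  filter_upwards [hC, hCa.eventually (gt_mem_nhds hη)] with k h1 h2
  rw [ENNReal.ofReal_toReal hε1] at h1
  refine (measure_mono fun ω hω => ?_).trans (h1.trans (min_le_left _ _))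
  rw [Set.mem_ofPred_eq, Real.dist_0_eq_abs, not_lt] at hω
  exact h2.trans_le hω

lemma IsBigOp.tendsto_mul_zero {Y Z : ℕ → Ω → ℝ} (hZ : IsBigOp P Z fun _ => 1)
    (hY : Tendsto (fun x : ℕ × Ω => Y x.1 x.2) (whp P) (𝓝 0)) :
    Tendsto (fun x : ℕ × Ω => Y x.1 x.2 * Z x.1 x.2) (whp P) (𝓝 0) := by
  rw [Metric.tendsto_nhds]
  intro η hη
  rw [eventually_whp_iff, ENNReal.tendsto_nhds_zero]
  intro ε hε
  have hε1 : min ε 1 ≠ ⊤ := ne_top_of_le_ne_top ENNReal.one_ne_top (min_le_right _ _)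
  have hε0 : 0 < (min ε 1).toReal := ENNReal.toReal_pos (lt_min hε one_pos).ne' hε1
  obtain ⟨C, hC0, hC⟩ := hZ.exists_nonneg (Eventually.of_forall fun _ => zero_le_one)
    (half_pos hε0)
  have hY' := eventually_whp_iff.1 (Metric.tendsto_nhds.1 hY (η / (C + 1)) (by positivity))
  have hY'' := (ENNReal.tendsto_nhds_zero.1 hY') (ENNReal.ofReal ((min ε 1).toReal / 2))
    (by simpa using hε0)
  filter_upwards [hC, hY''] with k h1 h2
  refine (measure_mono (t := {ω | C * 1 < |Z k ω|} ∪
    {ω | ¬ dist (Y k ω) 0 < η / (C + 1)}) fun ω hω => ?_).trans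
      ((measure_union_le _ _).trans ((add_le_add h1 h2).trans ?_))
  · by_contra h'
    simp only [Set.mem_union, Set.mem_ofPred_eq, not_or, not_lt, not_le, Real.dist_0_eq_abs,
      mul_one] at h' hω
    rw [abs_mul] at hω
    have h3 : |Y k ω| * (C + 1) < η := (lt_div_iff₀ (by positivity)).1 h'.2
    nlinarith [mul_le_mul_of_nonneg_left h'.1 (abs_nonneg (Y k ω)), abs_nonneg (Y k ω)]
  · rw [← ENNReal.ofReal_add (half_pos hε0).le (half_pos hε0).le, add_halves,
      ENNReal.ofReal_toReal hε1]
    exact min_le_left _ _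

/-- Chebyshev's inequality as a stochastic order. -/
lemma isBigOp_of_lintegral_sq_le {Y : ℕ → Ω → ℝ} {b : ℕ → ℝ} {M : ℝ} (hYm : ∀ k, Measurable (Y k))
    (hb : ∀ᶠ k in atTop, 0 < b k)
    (h : ∀ᶠ k in atTop, ∫⁻ ω, ENNReal.ofReal (Y k ω ^ 2) ∂P ≤ ENNReal.ofReal (M * b k ^ 2)) :
    IsBigOp P Y b := by
  intro ε hε
  set C := Real.sqrt ((|M| + 1) / ε) with hC
  have hM : 0 < (|M| + 1) / ε := by positivity
  have hC2 : C ^ 2 = (|M| + 1) / ε := Real.sq_sqrt hM.le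
  have hC0 : 0 < C := Real.sqrt_pos.2 hM
  refine ⟨C, ?_⟩
  filter_upwards [hb, h] with k hbk hk
  have hpos : 0 < C ^ 2 * b k ^ 2 := by positivity
  have h1 : P {ω | C * b k < |Y k ω|} ≤
      P {ω | ENNReal.ofReal (C ^ 2 * b k ^ 2) ≤ ENNReal.ofReal (Y k ω ^ 2)} := by
    refine measure_mono fun ω hω => ENNReal.ofReal_le_ofReal ?_
    have := pow_le_pow_left₀ (by positivity) (le_of_lt (show C * b k < |Y k ω| from hω)) 2
    rwa [mul_pow, sq_abs] at this
  refine h1.trans ((meas_ge_le_lintegral_div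
    (((hYm k).pow_const 2).ennreal_ofReal).aemeasurable
    (ENNReal.ofReal_pos.2 hpos).ne' ENNReal.ofReal_ne_top).trans ?_)
  refine (ENNReal.div_le_div_right hk _).trans ?_
  rw [← ENNReal.ofReal_div_of_pos hpos]
  refine ENNReal.ofReal_le_ofReal ?_
  rw [hC2, div_le_iff₀ (by positivity)]
  calc M * b k ^ 2 ≤ (|M| + 1) * b k ^ 2 := by
        gcongr
        linarith [le_abs_self M]
    _ = ε * ((|M| + 1) / ε * b k ^ 2) := by field_simp

end Probability

/-! ### Limits in distribution -/

section Distribution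

variable {Ω : Type*} [MeasurableSpace Ω] {P : Measure Ω} [IsProbabilityMeasure P] {r : ℕ}

lemma multivariateGaussian_map_mulVec {S : Matrix (Fin r) (Fin r) ℝ} (hS : S.PosSemidef)
    (B : Matrix (Fin r) (Fin r) ℝ) :
    (multivariateGaussian 0 S).map (Matrix.toEuclideanCLM (𝕜 := ℝ) B) =
      multivariateGaussian 0 (B * S * Bᵀ) := by
  have hBS : (B * S * Bᵀ).PosSemidef := by
    simpa [conjTranspose_eq_transpose_of_trivial] using hS.mul_mul_conjTranspose_same B
  refine Measure.ext_of_charFun ?_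
  ext x
  have hadj : ∀ y : EuclideanSpace ℝ (Fin r), inner ℝ (Matrix.toEuclideanCLM (𝕜 := ℝ) B y) x =
      inner ℝ y (WithLp.toLp 2 (Bᵀ *ᵥ x.ofLp)) := by
    intro y
    rw [EuclideanSpace.inner_eq_star_dotProduct, EuclideanSpace.inner_eq_star_dotProduct]
    simp only [star_trivial, Matrix.ofLp_toEuclideanCLM]
    rw [dotProduct_mulVec, ← mulVec_transpose]
  have hmap : charFun ((multivariateGaussian 0 S).map (Matrix.toEuclideanCLM (𝕜 := ℝ) B)) x =
      charFun (multivariateGaussian 0 S) (WithLp.toLp 2 (Bᵀ *ᵥ x.ofLp)) := by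
    rw [charFun_apply, charFun_apply, integral_map (by fun_prop)
      (Measurable.aestronglyMeasurable (by fun_prop))]
    simp_rw [hadj]
  rw [hmap, charFun_multivariateGaussian hBS, charFun_multivariateGaussian hS]
  have hq : (Bᵀ *ᵥ x.ofLp) ⬝ᵥ S *ᵥ (Bᵀ *ᵥ x.ofLp) = x.ofLp ⬝ᵥ (B * S * Bᵀ) *ᵥ x.ofLp := by
    nth_rw 1 [mulVec_transpose]
    rw [← dotProduct_mulVec, mulVec_mulVec, mulVec_mulVec]
  rw [hq]
  simp

/-- A form of Slutsky's theorem: the matrices `B k` converge in probability to `B`, the vectors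
`Z k` are stochastically bounded and asymptotically normal, and `Y k - B k Z k` is negligible. -/
lemma TendstoNormal.slutsky {Y Z : ℕ → Ω → EuclideanSpace ℝ (Fin r)}
    {S B : Matrix (Fin r) (Fin r) ℝ} {Bk : ℕ → Ω → Matrix (Fin r) (Fin r) ℝ}
    (hS : S.PosSemidef) (hZ : TendstoNormal P Z S)
    (hZ1 : IsBigOp P (fun k ω => ‖Z k ω‖) fun _ => 1)
    (hB : Tendsto (fun x : ℕ × Ω => Bk x.1 x.2) (whp P) (𝓝 B))
    (hY : Tendsto (fun x : ℕ × Ω => ‖Y x.1 x.2 - WithLp.toLp 2 (Bk x.1 x.2 *ᵥ (Z x.1 x.2).ofLp)‖)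
      (whp P) (𝓝 0))
    (hYm : ∀ k, AEMeasurable (Y k) P) : TendstoNormal P Y (B * S * Bᵀ) := by
  have h1 : TendstoInDistribution (fun k => Matrix.toEuclideanCLM (𝕜 := ℝ) B ∘ Z k) atTop
      (Matrix.toEuclideanCLM (𝕜 := ℝ) B ∘ id) (fun _ => P) (multivariateGaussian 0 S) :=
    TendstoInDistribution.continuous_comp (Matrix.toEuclideanCLM (𝕜 := ℝ) B).continuous hZ
  have h2 : TendstoInDistribution (fun k => Matrix.toEuclideanCLM (𝕜 := ℝ) B ∘ Z k) atTop
      (id : EuclideanSpace ℝ (Fin r) → EuclideanSpace ℝ (Fin r)) (fun _ => P)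
      (multivariateGaussian 0 (B * S * Bᵀ)) := by
    refine ⟨h1.forall_aemeasurable, aemeasurable_id, ?_⟩
    convert h1.tendsto using 3
    simp [← multivariateGaussian_map_mulVec hS B]
  have h3 : Tendsto (fun x : ℕ × Ω => frobNorm (Bk x.1 x.2 - B)) (whp P) (𝓝 0) := by
    have := (continuous_frobNorm.tendsto _).comp (hB.sub_const B)
    simpa only [sub_self, frobNorm_zero, Function.comp_def] using this
  have h4 := hZ1.tendsto_mul_zero (Y := fun k ω => frobNorm (Bk k ω - B)) h3
  have h5 := hY.add h4
  rw [add_zero] at h5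
  have h7 : Tendsto (fun x : ℕ × Ω => Y x.1 x.2 - Matrix.toEuclideanCLM (𝕜 := ℝ) B (Z x.1 x.2))
      (whp P) (𝓝 0) := by
    refine squeeze_zero_norm (fun x => ?_) h5
    have h6 : Y x.1 x.2 - Matrix.toEuclideanCLM (𝕜 := ℝ) B (Z x.1 x.2) =
        (Y x.1 x.2 - WithLp.toLp 2 (Bk x.1 x.2 *ᵥ (Z x.1 x.2).ofLp)) +
          WithLp.toLp 2 ((Bk x.1 x.2 - B) *ᵥ (Z x.1 x.2).ofLp) := by
      rw [sub_mulVec, WithLp.toLp_sub, sub_add_sub_cancel]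
      rfl
    rw [h6]
    exact (norm_add_le _ _).trans (add_le_add le_rfl (vnorm_mulVec_le _ _))
  have h8 : TendstoInMeasure P (Y - fun k => Matrix.toEuclideanCLM (𝕜 := ℝ) B ∘ Z k) atTop 0 :=
    tendstoInMeasure_const_iff
      (f := fun k ω => Y k ω - Matrix.toEuclideanCLM (𝕜 := ℝ) B (Z k ω)).2 h7
  exact tendstoInDistribution_of_tendstoInMeasure_sub Y _ h2 h8 hYm

end Distribution

/-! ### Consistency of the overlap matrix and the eigenvalues -/

section Consistency

variable {r : ℕ}

lemma exists_coercive {S : Matrix (Fin r) (Fin r) ℝ} (hS : S.PosDef) :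
    ∃ c : ℝ, 0 < c ∧ ∀ x : Fin r → ℝ, c * vnorm x ^ 2 ≤ x ⬝ᵥ S *ᵥ x := by
  set R := CFC.sqrt S with hR
  have hd := isUnit_det_sqrt hS
  refine ⟨(frobNorm R⁻¹ ^ 2 + 1)⁻¹, by positivity, fun x => ?_⟩
  have h1 : x ⬝ᵥ S *ᵥ x = vnorm (R *ᵥ x) ^ 2 := by
    rw [vnorm_sq_eq_dotProduct, dotProduct_mulVec (R *ᵥ x), vecMul_mulVec, hR, transpose_sqrt,
      sqrt_mul_sqrt_of_posDef hS, ← dotProduct_mulVec]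
  have h2 : vnorm x ≤ frobNorm R⁻¹ * vnorm (R *ᵥ x) := by
    have := vnorm_mulVec_le R⁻¹ (R *ᵥ x)
    rwa [mulVec_mulVec, nonsing_inv_mul _ hd, one_mulVec] at this
  have h3 := pow_le_pow_left₀ (vnorm_nonneg x) h2 2
  rw [mul_pow] at h3
  rw [h1, inv_mul_le_iff₀ (by positivity)]
  nlinarith [sq_nonneg (vnorm (R *ᵥ x))]

/-- If the Gram matrices of `F` converge to a positive definite matrix, then `F` is eventually
bounded below, uniformly. -/
lemma exists_eventually_vnorm_ge {β : Type*} {l : Filter β} {n : β → ℕ}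
    {F : ∀ b, Matrix (Fin (n b)) (Fin r) ℝ} {S : Matrix (Fin r) (Fin r) ℝ} (hS : S.PosDef)
    (hF : Tendsto (fun b => (F b)ᵀ * F b) l (𝓝 S)) :
    ∃ c : ℝ, 0 < c ∧ ∀ᶠ b in l, ∀ x, c * vnorm x ≤ vnorm (F b *ᵥ x) := by
  obtain ⟨c, hc, hcS⟩ := exists_coercive hS
  have h1 : Tendsto (fun b => frobNorm (S - (F b)ᵀ * F b)) l (𝓝 0) := by
    have := (continuous_frobNorm.tendsto _).comp
      (tendsto_const_nhds.sub hF : Tendsto _ _ (𝓝 (S - S)))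
    simpa only [sub_self, frobNorm_zero, Function.comp_def] using this
  refine ⟨Real.sqrt (c / 2), Real.sqrt_pos.2 (half_pos hc), ?_⟩
  filter_upwards [h1.eventually (gt_mem_nhds (half_pos hc))] with b hb x
  have h2 : vnorm (F b *ᵥ x) ^ 2 = x ⬝ᵥ S *ᵥ x - x ⬝ᵥ (S - (F b)ᵀ * F b) *ᵥ x := by
    rw [sub_mulVec, dotProduct_sub, sub_sub_cancel, vnorm_sq_eq_dotProduct, dotProduct_mulVec,
      vecMul_mulVec, ← dotProduct_mulVec]
  have h3 : x ⬝ᵥ (S - (F b)ᵀ * F b) *ᵥ x ≤ c / 2 * vnorm x ^ 2 := by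
    have h4 := dotProduct_le_vnorm x ((S - (F b)ᵀ * F b) *ᵥ x)
    have h5 := vnorm_mulVec_le (S - (F b)ᵀ * F b) x
    have h6 := vnorm_nonneg x
    nlinarith [mul_le_mul_of_nonneg_left h5 h6,
      mul_le_mul_of_nonneg_right hb.le (sq_nonneg (vnorm x))]
  refine le_of_sq_le_sq ?_ (vnorm_nonneg _)
  rw [mul_pow, Real.sq_sqrt (half_pos hc).le, h2]
  linarith [hcS x]

variable {SF SΛ Q : Matrix (Fin r) (Fin r) ℝ} {v : Fin r → ℝ} {β : Type*} {l : Filter β}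
  {N T : β → ℕ} {F Ft : ∀ b, Matrix (Fin (T b)) (Fin r) ℝ}
  {L Lt : ∀ b, Matrix (Fin (N b)) (Fin r) ℝ} {E : ∀ b, Matrix (Fin (T b)) (Fin (N b)) ℝ}
  {w : β → Fin r → ℝ}

lemma tendsto_frobNorm_of_gram {n : β → ℕ} {F : ∀ b, Matrix (Fin (n b)) (Fin r) ℝ}
    (hF : Tendsto (fun b => (F b)ᵀ * F b) l (𝓝 SF)) :
    Tendsto (fun b => frobNorm (F b)) l (𝓝 (Real.sqrt SF.trace)) := by
  have h1 := (continuous_id.matrix_trace.tendsto SF).comp hF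
  refine ((Real.continuous_sqrt.tendsto _).comp h1).congr fun b => ?_
  simp only [Function.comp, id]
  rw [← frobNorm_sq_eq_trace, Real.sqrt_sq (frobNorm_nonneg _)]

/-- Consistency: the overlap of estimated and true factors converges to `Q`, and the leading
eigenvalues converge to `v`. -/
lemma tendsto_overlap
    (hPC : ∀ᶠ b in l, PCProps 1 (F b * (L b)ᵀ + E b) (Ft b) (Lt b) (w b))
    (hF : Tendsto (fun b => (F b)ᵀ * F b) l (𝓝 SF)) (hSF : SF.PosDef)
    (hL : Tendsto (fun b => (L b)ᵀ * L b) l (𝓝 SΛ)) (hSΛ : SΛ.PosDef)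
    (hEL : Tendsto (fun b => frobNorm (E b * L b)) l (𝓝 0))
    (hE : Tendsto (fun b => spNorm (E b)) l (𝓝 0))
    (hsign : ∀ᶠ b in l, ∀ j, 0 ≤ ((Ft b)ᵀ * F b * Qᵀ) j j)
    (hQ : SF * SΛ * Qᵀ = Qᵀ * diagonal v) (hQS : Q * SΛ * Qᵀ = diagonal v)
    (hv : Antitone v) (hv0 : ∀ j, 0 < v j) (hvi : Function.Injective v) :
    Tendsto (fun b => (Ft b)ᵀ * F b) l (𝓝 Q) ∧ Tendsto w l (𝓝 v) := by
  have hφ := tendsto_frobNorm_of_gram hF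
  set φ := Real.sqrt SF.trace
  set C := Real.sqrt r * (φ + 1)
  have hbdd : ∀ᶠ b in l, frobNorm ((Ft b)ᵀ * F b) ≤ C := by
    filter_upwards [hPC, hφ.eventually (gt_mem_nhds (lt_add_one φ))] with b h1 h2
    exact h1.frobNorm_overlap.trans (mul_le_mul_of_nonneg_left h2.le (Real.sqrt_nonneg _))
  obtain ⟨cF, hcF, hcF'⟩ := exists_eventually_vnorm_ge hSF hF
  obtain ⟨cL, hcL, hcL'⟩ := exists_eventually_vnorm_ge hSΛ hL
  have hc : 0 < cF * cL / 2 := by positivity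
  have hlow : ∀ᶠ b in l, ∀ j, (cF * cL / 2) ^ 2 ≤ w b j := by
    filter_upwards [hPC, hcF', hcL', hE.eventually (gt_mem_nhds hc)] with b h1 h2 h3 h4 j
    have h5 := h1.sqrt_eigenvalue_ge hcF.le hcL.le h2 h3 j
    exact (Real.le_sqrt' hc).1 (by linarith)
  have hdS : Tendsto (fun b => frobNorm (SΛ - (L b)ᵀ * L b)) l (𝓝 0) := by
    have := (continuous_frobNorm.tendsto _).comp
      (tendsto_const_nhds.sub hL : Tendsto _ _ (𝓝 (SΛ - SΛ)))
    simpa only [sub_self, frobNorm_zero, Function.comp_def] using this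
  have hdK : Tendsto (fun b => frobNorm (SF * SΛ - (F b)ᵀ * F b * ((L b)ᵀ * L b))) l (𝓝 0) := by
    have := (continuous_frobNorm.tendsto _).comp
      (tendsto_const_nhds.sub (hF.mul hL) : Tendsto _ _ (𝓝 (SF * SΛ - SF * SΛ)))
    simpa only [sub_self, frobNorm_zero, Function.comp_def] using this
  refine tendsto_of_diagonalize (c := (cF * cL / 2) ^ 2) (C := C) (K := SF * SΛ) (S := SΛ) ?_ ?_
    (hPC.mono fun b h => h.antitone) (by positivity) hlow hbdd hsign hQ hQS hv hv0 hvi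
  · have hlim : Tendsto (fun b => frobNorm (SF * SΛ - (F b)ᵀ * F b * ((L b)ᵀ * L b)) * C +
        (frobNorm (F b) * frobNorm (F b) * frobNorm (E b * L b) * Real.sqrt r +
          frobNorm (F b) * frobNorm (E b * L b) * C +
          frobNorm (F b) * (spNorm (E b) * (spNorm (E b) * Real.sqrt r)))) l (𝓝 0) := by
      have := (hdK.mul_const C).add (((((hφ.mul hφ).mul hEL).mul_const (Real.sqrt r)).add
        ((hφ.mul hEL).mul_const C)).add (hφ.mul (hE.mul (hE.mul_const (Real.sqrt r)))))
      simpa using this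
    refine tendsto_zero_of_frobNorm (squeeze_zero' (Eventually.of_forall fun _ => frobNorm_nonneg _)
      ?_ hlim)
    filter_upwards [hPC, hbdd] with b h1 h2
    have h3 : SF * SΛ * ((Ft b)ᵀ * F b)ᵀ - ((Ft b)ᵀ * F b)ᵀ * diagonal (w b) =
        (SF * SΛ - (F b)ᵀ * F b * ((L b)ᵀ * L b)) * ((Ft b)ᵀ * F b)ᵀ +
        ((F b)ᵀ * F b * ((L b)ᵀ * L b) * ((Ft b)ᵀ * F b)ᵀ -
          ((Ft b)ᵀ * F b)ᵀ * diagonal (w b)) := by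
      rw [Matrix.sub_mul, sub_add_sub_cancel]
    rw [h3]
    refine (frobNorm_add_le _ _).trans (add_le_add ((frobNorm_mul_le _ _).trans ?_)
      (h1.frobNorm_eigen_sub_le.trans ?_))
    · rw [frobNorm_transpose]
      exact mul_le_mul_of_nonneg_left h2 (frobNorm_nonneg _)
    · have := mul_le_mul_of_nonneg_left h2
        (mul_nonneg (frobNorm_nonneg (F b)) (frobNorm_nonneg (E b * L b)))
      linarith
  · have hlim : Tendsto (fun b => C * frobNorm (SΛ - (L b)ᵀ * L b) * C +
        (2 * (C * frobNorm (E b * L b) * Real.sqrt r) + (Real.sqrt r * spNorm (E b)) ^ 2))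
        l (𝓝 0) := by
      have := ((hdS.const_mul C).mul_const C).add ((((hEL.const_mul C).mul_const
        (Real.sqrt r)).const_mul 2).add ((hE.const_mul (Real.sqrt r)).pow 2))
      simpa using this
    refine tendsto_zero_of_frobNorm (squeeze_zero' (Eventually.of_forall fun _ => frobNorm_nonneg _)
      ?_ hlim)
    filter_upwards [hPC, hbdd] with b h1 h2
    set A := (Ft b)ᵀ * F b
    have h3 : A * SΛ * Aᵀ - diagonal (w b) = A * (SΛ - (L b)ᵀ * L b) * Aᵀ +
        (A * ((L b)ᵀ * L b) * Aᵀ - diagonal (w b)) := by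
      rw [Matrix.mul_sub, Matrix.sub_mul, sub_add_sub_cancel]
    have hC : 0 ≤ C := (frobNorm_nonneg _).trans h2
    rw [h3]
    refine (frobNorm_add_le _ _).trans (add_le_add ((frobNorm_mul_le _ _).trans ?_)
      (h1.frobNorm_gram_sub_le.trans ?_))
    · rw [frobNorm_transpose]
      refine mul_le_mul ((frobNorm_mul_le _ _).trans ?_) h2 (frobNorm_nonneg _)
        (mul_nonneg hC (frobNorm_nonneg _))
      exact mul_le_mul_of_nonneg_right h2 (frobNorm_nonneg _)
    · have := mul_le_mul_of_nonneg_right h2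
        (mul_nonneg (frobNorm_nonneg (E b * L b)) (Real.sqrt_nonneg r))
      change 2 * (frobNorm A * frobNorm (E b * L b) * Real.sqrt r) + _ ≤ _
      linarith

lemma tendsto_diagonal_inv (hw : Tendsto w l (𝓝 v)) (hv0 : ∀ j, 0 < v j) :
    Tendsto (fun b => diagonal (w b)⁻¹) l (𝓝 (diagonal v⁻¹)) :=
  (continuous_id.matrix_diagonal.tendsto v⁻¹).comp
    (tendsto_pi_nhds.2 fun j => (tendsto_pi_nhds.1 hw j).inv₀ (hv0 j).ne')

lemma inv_eq_of_gram (hQS : Q * SΛ * Qᵀ = diagonal v) (hv0 : ∀ j, 0 < v j) :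
    Q⁻¹ = SΛ * Qᵀ * diagonal v⁻¹ := by
  refine inv_eq_right_inv ?_
  rw [← Matrix.mul_assoc, ← Matrix.mul_assoc, hQS, diagonal_mul_inv fun j => (hv0 j).ne']

/-- The rotation that relates estimated to true factors converges to the inverse of `Q`. -/
lemma tendsto_rotation
    (hPC : ∀ᶠ b in l, PCProps 1 (F b * (L b)ᵀ + E b) (Ft b) (Lt b) (w b))
    (hL : Tendsto (fun b => (L b)ᵀ * L b) l (𝓝 SΛ))
    (hEL : Tendsto (fun b => frobNorm (E b * L b)) l (𝓝 0))
    (hA : Tendsto (fun b => (Ft b)ᵀ * F b) l (𝓝 Q)) (hw : Tendsto w l (𝓝 v))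
    (hQS : Q * SΛ * Qᵀ = diagonal v) (hv0 : ∀ j, 0 < v j) :
    Tendsto (fun b => (L b)ᵀ * Lt b * diagonal (w b)⁻¹) l (𝓝 Q⁻¹) := by
  have h1 : Tendsto (fun b => (L b)ᵀ * Lt b - (L b)ᵀ * L b * ((Ft b)ᵀ * F b)ᵀ) l (𝓝 0) := by
    refine tendsto_zero_of_frobNorm (squeeze_zero' (Eventually.of_forall fun _ => frobNorm_nonneg _)
      (hPC.mono fun b h => h.frobNorm_cross_sub_le) ?_)
    simpa using hEL.mul_const (Real.sqrt r)
  have h2 : Tendsto (fun b => (L b)ᵀ * Lt b) l (𝓝 (SΛ * Qᵀ)) := by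
    have h3 := h1.add (hL.mul ((continuous_id.matrix_transpose.tendsto Q).comp hA))
    simpa [Function.comp_def] using h3
  rw [inv_eq_of_gram hQS hv0]
  exact h2.mul (tendsto_diagonal_inv hw hv0)

end Consistency

/-! ### Rates -/

/-- The relations between `s = √N`, `q = √T` and `b = √(N ^ α)` that the sequence of sample sizes
satisfies. -/
structure Rates (s q b : ℕ → ℝ) : Prop where
  pos_q : ∀ᶠ k in atTop, 0 < q k
  one_le_b : ∀ᶠ k in atTop, 1 ≤ b k
  b_le_s : ∀ᶠ k in atTop, b k ≤ s k
  tendsto_b : Tendsto b atTop atTop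
  lim_s : Tendsto (fun k => s k / b k ^ 2) atTop (𝓝 0)
  lim_q : Tendsto (fun k => q k / b k ^ 2) atTop (𝓝 0)
  lim_sq : Tendsto (fun k => s k ^ 2 / (q k * b k ^ 2)) atTop (𝓝 0)
  lim_cube : Tendsto (fun k => s k ^ 3 / (q k ^ 2 * b k ^ 2)) atTop (𝓝 0)
  lim_noise : Tendsto (fun k => s k ^ 2 / (q k ^ 2 * b k ^ 2)) atTop (𝓝 0)

namespace Rates

variable {s q b : ℕ → ℝ}

lemma pos_s (h : Rates s q b) : ∀ᶠ k in atTop, 0 < s k := by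
  filter_upwards [h.one_le_b, h.b_le_s] with k h1 h2 using by linarith

lemma inv_b (h : Rates s q b) : Tendsto (fun k => 1 / b k) atTop (𝓝 0) := by
  exact h.tendsto_b.inv_tendsto_atTop.congr fun k => (one_div (b k)).symm

lemma spectral (h : Rates s q b) : Tendsto (fun k => (s k + q k) / (b k * q k)) atTop (𝓝 0) := by
  have h1 : Tendsto (fun k => Real.sqrt (s k ^ 2 / (q k ^ 2 * b k ^ 2)) + 1 / b k) atTop (𝓝 0) := by
    have := ((Real.continuous_sqrt.tendsto 0).comp h.lim_noise).add h.inv_b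
    simpa [Function.comp_def] using this
  refine h1.congr' ?_
  filter_upwards [h.pos_s, h.pos_q, h.one_le_b] with k hs hq hb
  have hb0 : 0 < b k := by linarith
  rw [← mul_pow, ← div_pow, Real.sqrt_sq (by positivity)]
  field_simp

lemma ratio (h : Rates s q b) : Tendsto (fun k => s k ^ 2 / (q k ^ 2 * b k)) atTop (𝓝 0) := by
  refine squeeze_zero' ?_ ?_ h.lim_cube
  · filter_upwards [h.pos_s, h.pos_q, h.one_le_b] with k hs hq hb
    positivity
  · filter_upwards [h.pos_s, h.pos_q, h.one_le_b, h.b_le_s] with k hs hq hb hbs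
    have hb0 : 0 < b k := by linarith
    rw [div_le_div_iff₀ (by positivity) (by positivity)]
    have : 0 ≤ s k ^ 2 * q k ^ 2 * b k := by positivity
    nlinarith [mul_le_mul_of_nonneg_left hbs this]

lemma factor_noise (h : Rates s q b) :
    Tendsto (fun k => (1 + s k ^ 2 / q k ^ 2) / b k) atTop (𝓝 0) := by
  have h1 := h.inv_b.add h.ratio
  rw [add_zero] at h1
  refine h1.congr' ?_
  filter_upwards [h.pos_q, h.one_le_b] with k hq hb
  have hb0 : 0 < b k := by linarith
  field_simp

lemma loading_noise_mul (h : Rates s q b) :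
    Tendsto (fun k => 1 / b k * ((s k + s k ^ 2 / q k) / b k)) atTop (𝓝 0) := by
  have h1 := h.lim_s.add h.lim_sq
  rw [add_zero] at h1
  refine h1.congr' ?_
  filter_upwards [h.pos_q, h.one_le_b] with k hq hb
  have hb0 : 0 < b k := by linarith
  field_simp

lemma spectral_sq_mul (h : Rates s q b) :
    Tendsto (fun k => (s k + q k) / (b k * q k) * ((s k + q k) / (b k * q k)) *
      ((s k + s k ^ 2 / q k) / b k)) atTop (𝓝 0) := by
  have h1 := (h.lim_s.add (h.lim_sq.mul h.ratio)).const_mul 4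
  simp only [mul_zero, add_zero] at h1
  refine squeeze_zero' ?_ ?_ h1
  · filter_upwards [h.pos_s, h.pos_q, h.one_le_b] with k hs hq hb
    positivity
  · filter_upwards [h.pos_s, h.pos_q, h.one_le_b] with k hs hq hb
    have hb0 : 0 < b k := by linarith
    set x := s k / q k with hx
    have hx0 : 0 < x := by positivity
    have hsx : s k = x * q k := by rw [hx]; field_simp
    have e1 : (s k + q k) / (b k * q k) * ((s k + q k) / (b k * q k)) *
        ((s k + s k ^ 2 / q k) / b k) = s k / b k ^ 3 * (1 + x) ^ 3 := by
      rw [hsx]; field_simp; ring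
    have e2 : s k ^ 2 / (q k * b k ^ 2) * (s k ^ 2 / (q k ^ 2 * b k)) = s k / b k ^ 3 * x ^ 3 := by
      rw [hsx]; field_simp
    have e3 : s k / b k ^ 3 ≤ s k / b k ^ 2 := by
      gcongr
      norm_num
    have e4 : (1 + x) ^ 3 ≤ 4 * (1 + x ^ 3) := by nlinarith [sq_nonneg (x - 1)]
    have e5 : 0 ≤ s k / b k ^ 3 := by positivity
    rw [e1, e2]
    nlinarith [mul_le_mul_of_nonneg_left e4 e5]

lemma loading_noise (h : Rates s q b) : Tendsto (fun k => q k / b k ^ 2 + 1 / b k) atTop (𝓝 0) := by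
  simpa using h.lim_q.add h.inv_b

lemma spectral_mul (h : Rates s q b) :
    Tendsto (fun k => (s k + q k) / (b k * q k) * ((q k + s k) / b k)) atTop (𝓝 0) := by
  have h1 := (h.lim_sq.add (h.lim_s.const_mul 2)).add h.lim_q
  simp only [mul_zero, add_zero] at h1
  refine h1.congr' ?_
  filter_upwards [h.pos_q, h.one_le_b] with k hq hb
  have hb0 : 0 < b k := by linarith
  field_simp
  ring

end Rates

lemma rates_of_assumptions {N T : ℕ → ℕ} {α : ℝ} (hN : Tendsto N atTop atTop)
    (hT : Tendsto T atTop atTop) (h0 : 0 < α) (h1 : α ≤ 1) (h4 : AssumptionA4 N T α)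
    (hC : AssumptionC N T α) :
    Rates (fun k => Real.sqrt (N k)) (fun k => Real.sqrt (T k))
      (fun k => Real.sqrt ((N k : ℝ) ^ α)) := by
  have hN1 : ∀ᶠ k in atTop, (1 : ℝ) ≤ N k := by
    filter_upwards [hN.eventually_ge_atTop 1] with k hk using by exact_mod_cast hk
  have hT1 : ∀ᶠ k in atTop, (1 : ℝ) ≤ T k := by
    filter_upwards [hT.eventually_ge_atTop 1] with k hk using by exact_mod_cast hk
  have hNr : Tendsto (fun k => (N k : ℝ)) atTop atTop := tendsto_natCast_atTop_atTop.comp hN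
  have hb2 : ∀ k, Real.sqrt ((N k : ℝ) ^ α) ^ 2 = (N k : ℝ) ^ α := fun k =>
    Real.sq_sqrt (by positivity)
  have hs2 : ∀ k, Real.sqrt (N k) ^ 2 = (N k : ℝ) := fun k => Real.sq_sqrt (by positivity)
  have hq2 : ∀ k, Real.sqrt (T k) ^ 2 = (T k : ℝ) := fun k => Real.sq_sqrt (by positivity)
  constructor
  · filter_upwards [hT1] with k hk using Real.sqrt_pos.2 (by linarith)
  · filter_upwards [hN1] with k hk
    exact Real.one_le_sqrt.2 (Real.one_le_rpow hk h0.le)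
  · filter_upwards [hN1] with k hk
    refine Real.sqrt_le_sqrt ?_
    calc (N k : ℝ) ^ α ≤ (N k : ℝ) ^ (1 : ℝ) := Real.rpow_le_rpow_of_exponent_le hk h1
      _ = N k := Real.rpow_one _
  · exact Real.tendsto_sqrt_atTop.comp ((tendsto_rpow_atTop h0).comp hNr)
  · have h2 : Tendsto (fun k => (N k : ℝ) ^ (-(α - 1 / 2))) atTop (𝓝 0) :=
      (tendsto_rpow_neg_atTop (by linarith [hC.half_lt])).comp hNr
    refine h2.congr' ?_
    filter_upwards [hN1] with k hk
    rw [hb2, Real.sqrt_eq_rpow, ← Real.rpow_sub (by linarith)]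
    congr 1; ring
  · simpa only [hb2] using hC.rate_T
  · refine hC.rate_N.congr fun k => ?_
    rw [hb2, hs2, div_mul_div_comm, one_mul]
  · refine hC.rate_N'.congr' ?_
    filter_upwards [hN1] with k hk
    rw [hb2, hq2, div_mul_div_comm, one_mul, Real.sqrt_eq_rpow, ← Real.rpow_natCast,
      ← Real.rpow_mul (by linarith)]
    norm_num
  · refine Tendsto.congr (fun k => ?_) h4
    rw [hb2, hs2, hq2, div_mul_div_comm, mul_one, mul_comm (T k : ℝ)]

/-! ### Stochastic orders of the error terms -/

lemma spNorm_smul {ι κ : Type*} [Fintype ι] [Fintype κ] [DecidableEq κ] (c : ℝ)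
    (A : Matrix ι κ ℝ) : spNorm (c • A) = |c| * spNorm A := by
  rw [spNorm, spNorm, map_smul, map_smul, norm_smul, Real.norm_eq_abs]

namespace FactorModel

variable {Ω : Type*} [MeasurableSpace Ω] {r : ℕ}

/-- The factors divided by `√T`, so that their Gram matrix converges. -/
def scaledF (m : FactorModel Ω r) (T : ℕ) (ω : Ω) : Matrix (Fin T) (Fin r) ℝ :=
  (Real.sqrt T)⁻¹ • m.Fmat T ω

/-- The loadings divided by `√(N ^ α)`, so that their Gram matrix converges. -/
def scaledΛ (m : FactorModel Ω r) (α : ℝ) (N : ℕ) (ω : Ω) : Matrix (Fin N) (Fin r) ℝ :=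
  (Real.sqrt ((N : ℝ) ^ α))⁻¹ • m.Λmat N ω

/-- The errors on the scale on which the common component is of order one. -/
def scaledE (m : FactorModel Ω r) (α : ℝ) (N T : ℕ) (ω : Ω) : Matrix (Fin T) (Fin N) ℝ :=
  ((Real.sqrt ((N : ℝ) ^ α))⁻¹ * (Real.sqrt T)⁻¹) • m.emat N T ω

/-- The normalized sum over units of loadings times errors at time `t`. -/
def crossSum (m : FactorModel Ω r) (α : ℝ) (N t : ℕ) (ω : Ω) : EuclideanSpace ℝ (Fin r) :=
  (1 / Real.sqrt ((N : ℝ) ^ α)) • ∑ i ∈ Finset.range N, m.e i t ω • m.Λ N i ω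

/-- The normalized sum over time of factors times errors of unit `i`. -/
def timeSum (m : FactorModel Ω r) (T i : ℕ) (ω : Ω) : EuclideanSpace ℝ (Fin r) :=
  (1 / Real.sqrt T) • ∑ t ∈ Finset.range T, m.e i t ω • m.F t ω

lemma scaled_X (m : FactorModel Ω r) (α : ℝ) (N T : ℕ) (ω : Ω) :
    ((Real.sqrt ((N : ℝ) ^ α))⁻¹ * (Real.sqrt T)⁻¹) • m.X N T ω =
      m.scaledF T ω * (m.scaledΛ α N ω)ᵀ + m.scaledE α N T ω := by
  rw [X, scaledF, scaledΛ, scaledE, smul_add, transpose_smul, Matrix.smul_mul, Matrix.mul_smul,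
    smul_smul, mul_comm]

lemma crossSum_eq (m : FactorModel Ω r) (α : ℝ) (N t : ℕ) (ω : Ω) :
    (m.crossSum α N t ω).ofLp = (m.scaledΛ α N ω)ᵀ *ᵥ m.eTime N t ω := by
  ext a
  simp only [crossSum, scaledΛ, Λmat, rows, eTime, mulVec, dotProduct, transpose_apply,
    Matrix.smul_apply, of_apply, PiLp.smul_apply, smul_eq_mul, WithLp.ofLp_sum, WithLp.ofLp_smul,
    Finset.sum_apply, Pi.smul_apply]
  rw [Finset.sum_range, Finset.mul_sum]
  exact Finset.sum_congr rfl fun i _ => by ring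

lemma timeSum_eq (m : FactorModel Ω r) (T i : ℕ) (ω : Ω) :
    (m.timeSum T i ω).ofLp = (m.scaledF T ω)ᵀ *ᵥ m.eUnit T i ω := by
  ext a
  simp only [timeSum, scaledF, Fmat, rows, eUnit, mulVec, dotProduct, transpose_apply,
    Matrix.smul_apply, of_apply, PiLp.smul_apply, smul_eq_mul, WithLp.ofLp_sum, WithLp.ofLp_smul,
    Finset.sum_apply, Pi.smul_apply]
  rw [Finset.sum_range, Finset.mul_sum]
  exact Finset.sum_congr rfl fun i _ => by ring

lemma measurable_crossSum (m : FactorModel Ω r) (α : ℝ) (N t : ℕ) :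
    Measurable (m.crossSum α N t) := by
  unfold crossSum
  exact (Finset.measurable_sum _ fun i _ =>
    (m.measurable_e i t).smul (m.measurable_Λ N i)).const_smul (1 / Real.sqrt ((N : ℝ) ^ α))

lemma measurable_timeSum (m : FactorModel Ω r) (T i : ℕ) : Measurable (m.timeSum T i) := by
  unfold timeSum
  exact (Finset.measurable_sum _ fun t _ =>
    (m.measurable_e i t).smul (m.measurable_F t)).const_smul (1 / Real.sqrt (T : ℝ))

lemma frobNorm_scaledE_mul_sq (m : FactorModel Ω r) (α : ℝ) (N T : ℕ) (ω : Ω) :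
    frobNorm (m.scaledE α N T ω * m.scaledΛ α N ω) ^ 2 =
      ∑ t : Fin T, ((Real.sqrt ((N : ℝ) ^ α))⁻¹ * (Real.sqrt T)⁻¹) ^ 2 *
        ‖m.crossSum α N t ω‖ ^ 2 := by
  rw [← frobNorm_transpose, frobNorm_sq_eq_sum_vnorm]
  refine Finset.sum_congr rfl fun t _ => ?_
  have h : (fun i => (m.scaledE α N T ω * m.scaledΛ α N ω)ᵀ i t) =
      ((Real.sqrt ((N : ℝ) ^ α))⁻¹ * (Real.sqrt T)⁻¹) • (m.crossSum α N t ω).ofLp := by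
    rw [crossSum_eq]
    ext a
    simp only [transpose_apply, mul_apply, scaledE, emat, Matrix.smul_apply, of_apply, smul_eq_mul,
      Pi.smul_apply, mulVec, dotProduct, eTime, Finset.mul_sum]
    exact Finset.sum_congr rfl fun i _ => by ring
  rw [h, vnorm_smul, mul_pow, sq_abs]
  rfl

end FactorModel

section Orders

variable {Ω : Type*} [MeasurableSpace Ω] {P : Measure Ω} {r : ℕ}

lemma IsBigOp.of_eq_mul {Y Z : ℕ → Ω → ℝ} {a b c : ℕ → ℝ} (hY : IsBigOp P Y a)
    (ha : ∀ᶠ k in atTop, 0 ≤ a k) (h : ∀ᶠ k in atTop, ∀ ω, Z k ω = c k * Y k ω)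
    (hab : ∀ᶠ k in atTop, |c k| * a k ≤ b k) : IsBigOp P Z b := by
  intro ε hε
  obtain ⟨C, hC0, hC⟩ := (hY.const_mul ha c).exists_nonneg
    (by filter_upwards [ha] with k hk using mul_nonneg (abs_nonneg _) hk) hε
  refine ⟨C, ?_⟩
  filter_upwards [hC, h, hab] with k h1 h2 h3
  refine (measure_mono fun ω hω => ?_).trans h1
  have h4 : C * b k < |Z k ω| := hω
  show C * (|c k| * a k) < |c k * Y k ω|
  rw [← h2]
  exact (mul_le_mul_of_nonneg_left h3 hC0).trans_lt h4

variable {m : FactorModel Ω r} {N T : ℕ → ℕ} {M α : ℝ}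

lemma rpow_neg_half_eq (n : ℕ) (α : ℝ) :
    (n : ℝ) ^ (-α / 2) = 1 / Real.sqrt ((n : ℝ) ^ α) := by
  have hn : (0 : ℝ) ≤ n := Nat.cast_nonneg n
  rw [Real.sqrt_eq_rpow, ← Real.rpow_mul hn, one_div, ← Real.rpow_neg hn]
  congr 1; ring

lemma AssumptionA3.lintegral_crossSum (h : AssumptionA3 P m N T M α) {k t : ℕ} (ht : t < T k) :
    ∫⁻ ω, ENNReal.ofReal (‖m.crossSum α (N k) t ω‖ ^ 2) ∂P ≤ ENNReal.ofReal M := by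
  have := h.loading_error k t ht
  simpa only [rpow_neg_half_eq, FactorModel.crossSum] using this

lemma AssumptionA3.isBigOp_crossSum (h : AssumptionA3 P m N T M α) (hT : Tendsto T atTop atTop)
    (t : ℕ) : IsBigOp P (fun k ω => ‖m.crossSum α (N k) t ω‖) fun _ => 1 := by
  refine isBigOp_of_lintegral_sq_le (M := M) (fun k => (m.measurable_crossSum α (N k) t).norm)
    (Eventually.of_forall fun _ => one_pos) ?_
  filter_upwards [hT.eventually_gt_atTop t] with k hk
  simpa using h.lintegral_crossSum hk

lemma AssumptionA3.isBigOp_timeSum (h : AssumptionA3 P m N T M α) (hN : Tendsto N atTop atTop)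
    (i : ℕ) : IsBigOp P (fun k ω => ‖m.timeSum (T k) i ω‖) fun _ => 1 := by
  refine isBigOp_of_lintegral_sq_le (M := M) (fun k => (m.measurable_timeSum (T k) i).norm)
    (Eventually.of_forall fun _ => one_pos) ?_
  filter_upwards [hN.eventually_gt_atTop i] with k hk
  simpa only [one_pow, mul_one, FactorModel.timeSum] using h.factor_error k i hk

/-- The sequence of sample sizes, on the scale of `Rates`. -/
abbrev SizeRates (N T : ℕ → ℕ) (α : ℝ) : Prop :=
  Rates (fun k => Real.sqrt (N k)) (fun k => Real.sqrt (T k))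
    (fun k => Real.sqrt ((N k : ℝ) ^ α))

lemma isBigOp_loading_noise (h : AssumptionA3 P m N T M α) (hR : SizeRates N T α) :
    IsBigOp P (fun k ω => frobNorm (m.scaledE α (N k) (T k) ω * m.scaledΛ α (N k) ω))
      (fun k => 1 / Real.sqrt ((N k : ℝ) ^ α)) := by
  refine isBigOp_of_lintegral_sq_le (M := M) (fun k => ?_) ?_ ?_
  · have h1 : (fun ω => frobNorm (m.scaledE α (N k) (T k) ω * m.scaledΛ α (N k) ω)) = fun ω =>
        Real.sqrt (∑ t : Fin (T k), ((Real.sqrt ((N k : ℝ) ^ α))⁻¹ * (Real.sqrt (T k))⁻¹) ^ 2 *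
          ‖m.crossSum α (N k) t ω‖ ^ 2) := by
      funext ω
      rw [← m.frobNorm_scaledE_mul_sq, Real.sqrt_sq (frobNorm_nonneg _)]
    show Measurable fun ω => frobNorm (m.scaledE α (N k) (T k) ω * m.scaledΛ α (N k) ω)
    rw [h1]
    exact (Finset.measurable_sum _ fun (t : Fin (T k)) _ =>
      ((m.measurable_crossSum α (N k) t).norm.pow_const 2).const_mul _).sqrt
  · filter_upwards [hR.one_le_b] with k hk
    exact one_div_pos.2 (by linarith)
  · filter_upwards [hR.one_le_b, hR.pos_q] with k hb hq
    simp only [m.frobNorm_scaledE_mul_sq]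
    set c := ((Real.sqrt ((N k : ℝ) ^ α))⁻¹ * (Real.sqrt (T k))⁻¹) ^ 2 with hc
    have hc0 : 0 ≤ c := sq_nonneg _
    have hb0 : 0 < Real.sqrt ((N k : ℝ) ^ α) := by linarith
    calc ∫⁻ ω, ENNReal.ofReal (∑ t : Fin (T k), c * ‖m.crossSum α (N k) t ω‖ ^ 2) ∂P
        = ∫⁻ ω, ∑ t : Fin (T k), ENNReal.ofReal c *
            ENNReal.ofReal (‖m.crossSum α (N k) t ω‖ ^ 2) ∂P := by
          refine lintegral_congr fun ω => ?_
          rw [ENNReal.ofReal_sum_of_nonneg fun t _ => by positivity]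
          exact Finset.sum_congr rfl fun t _ => ENNReal.ofReal_mul hc0
      _ = ∑ t : Fin (T k), ENNReal.ofReal c *
            ∫⁻ ω, ENNReal.ofReal (‖m.crossSum α (N k) t ω‖ ^ 2) ∂P := by
          rw [lintegral_finsetSum _ fun (t : Fin (T k)) _ =>
            (((m.measurable_crossSum α (N k) t).norm.pow_const 2).ennreal_ofReal).const_mul _]
          exact Finset.sum_congr rfl fun t _ => lintegral_const_mul _
            ((m.measurable_crossSum α (N k) t).norm.pow_const 2).ennreal_ofReal
      _ ≤ ∑ _t : Fin (T k), ENNReal.ofReal c * ENNReal.ofReal M :=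
          Finset.sum_le_sum fun t _ => by
            gcongr
            exact h.lintegral_crossSum t.2
      _ = ENNReal.ofReal ((T k : ℝ) * (c * M)) := by
          rw [Finset.sum_const, Finset.card_univ, Fintype.card_fin, nsmul_eq_mul,
            ← ENNReal.ofReal_mul hc0, ENNReal.ofReal_mul (Nat.cast_nonneg _),
            ENNReal.ofReal_natCast]
      _ = ENNReal.ofReal (M * (1 / Real.sqrt ((N k : ℝ) ^ α)) ^ 2) := by
          have hT2 : Real.sqrt (T k) ^ 2 = T k := Real.sq_sqrt (Nat.cast_nonneg _)
          congr 1
          rw [show (T k : ℝ) * (c * M) = Real.sqrt (T k) ^ 2 * (c * M) by rw [hT2], hc]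
          field_simp

lemma isBigOp_spectral (h : AssumptionA1 P m N T M) :
    IsBigOp P (fun k ω => spNorm (m.scaledE α (N k) (T k) ω))
      (fun k => (Real.sqrt (N k) + Real.sqrt (T k)) /
        (Real.sqrt ((N k : ℝ) ^ α) * Real.sqrt (T k))) := by
  have h1 : IsBigOp P (fun k ω => spNorm (m.emat (N k) (T k) ω))
      (fun k => Real.sqrt (max (N k : ℝ) (T k : ℝ))) :=
    h.spectral_bound.of_sq (Eventually.of_forall fun k => by positivity)
  refine h1.of_eq_mul (c := fun k => (Real.sqrt ((N k : ℝ) ^ α))⁻¹ * (Real.sqrt (T k))⁻¹)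
    (Eventually.of_forall fun k => Real.sqrt_nonneg _)
    (Eventually.of_forall fun k ω => ?_) (Eventually.of_forall fun k => ?_)
  · rw [FactorModel.scaledE, spNorm_smul, abs_of_nonneg (by positivity)]
  · rw [abs_of_nonneg (by positivity), ← mul_inv, inv_mul_eq_div]
    gcongr
    rw [Real.sqrt_le_left (by positivity)]
    have h2 := Real.sq_sqrt (Nat.cast_nonneg (α := ℝ) (N k))
    have h3 := Real.sq_sqrt (Nat.cast_nonneg (α := ℝ) (T k))
    have h4 : 0 ≤ Real.sqrt (N k) * Real.sqrt (T k) := by positivity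
    refine max_le ?_ ?_ <;> nlinarith

lemma δ_inv_le {n t : ℕ} (hn : 0 < Real.sqrt n) (ht : 0 < Real.sqrt t) :
    (δ n t)⁻¹ ≤ 1 / Real.sqrt n + 1 / Real.sqrt t := by
  have h1 : 0 < 1 / Real.sqrt n := one_div_pos.2 hn
  have h2 : 0 < 1 / Real.sqrt t := one_div_pos.2 ht
  rw [δ]
  rcases min_choice (Real.sqrt n) (Real.sqrt t) with h | h <;> rw [h, inv_eq_one_div] <;> linarith

lemma δ_sq_inv_le {n t : ℕ} (hn : 0 < Real.sqrt n) (ht : 0 < Real.sqrt t) :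
    (δ n t ^ 2)⁻¹ ≤ 1 / Real.sqrt n ^ 2 + 1 / Real.sqrt t ^ 2 := by
  have h1 : 0 < 1 / Real.sqrt n ^ 2 := by positivity
  have h2 : 0 < 1 / Real.sqrt t ^ 2 := by positivity
  rw [δ]
  rcases min_choice (Real.sqrt n) (Real.sqrt t) with h | h <;> rw [h, inv_eq_one_div] <;> linarith

lemma δ_nonneg (n t : ℕ) : 0 ≤ δ n t := le_min (Real.sqrt_nonneg _) (Real.sqrt_nonneg _)

lemma isBigOp_row (h : AssumptionA1 P m N T M) (hR : SizeRates N T α) (t : ℕ) :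
    IsBigOp P (fun k ω => vnorm (m.scaledE α (N k) (T k) ω *ᵥ m.eTime (N k) t ω))
      (fun k => (Real.sqrt (N k) + Real.sqrt (N k) ^ 2 / Real.sqrt (T k)) /
        Real.sqrt ((N k : ℝ) ^ α)) := by
  refine (h.row_bound t).of_eq_mul
    (c := fun k => Real.sqrt (N k) ^ 2 / Real.sqrt ((N k : ℝ) ^ α))
    (Eventually.of_forall fun k => inv_nonneg.2 (δ_nonneg _ _)) ?_ ?_
  · filter_upwards [hR.pos_s, hR.pos_q, hR.one_le_b] with k hs hq hb ω
    have hb0 : 0 < Real.sqrt ((N k : ℝ) ^ α) := by linarith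
    have hN2 : Real.sqrt (N k) ^ 2 = N k := Real.sq_sqrt (Nat.cast_nonneg _)
    have hN0 : (0 : ℝ) < N k := hN2 ▸ by positivity
    rw [FactorModel.scaledE, smul_mulVec, vnorm_smul, abs_of_nonneg (by positivity),
      vecMul_transpose, hN2]
    field_simp
  · filter_upwards [hR.pos_s, hR.pos_q, hR.one_le_b] with k hs hq hb
    have hb0 : 0 < Real.sqrt ((N k : ℝ) ^ α) := by linarith
    rw [abs_of_nonneg (by positivity)]
    refine (mul_le_mul_of_nonneg_left (δ_inv_le hs hq) (by positivity)).trans_eq ?_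
    field_simp

lemma isBigOp_col (h : AssumptionA1 P m N T M) (hR : SizeRates N T α) (i : ℕ) :
    IsBigOp P (fun k ω => vnorm ((m.scaledE α (N k) (T k) ω)ᵀ *ᵥ m.eUnit (T k) i ω))
      (fun k => (Real.sqrt (T k) + Real.sqrt (N k)) / Real.sqrt ((N k : ℝ) ^ α)) := by
  refine (h.col_bound i).of_eq_mul
    (c := fun k => Real.sqrt (T k) * Real.sqrt (N k) / Real.sqrt ((N k : ℝ) ^ α))
    (Eventually.of_forall fun k => inv_nonneg.2 (δ_nonneg _ _)) ?_ ?_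
  · filter_upwards [hR.pos_s, hR.pos_q, hR.one_le_b] with k hs hq hb ω
    have hb0 : 0 < Real.sqrt ((N k : ℝ) ^ α) := by linarith
    have hT2 : Real.sqrt (T k) ^ 2 = T k := Real.sq_sqrt (Nat.cast_nonneg _)
    rw [FactorModel.scaledE, transpose_smul, smul_mulVec, vnorm_smul,
      abs_of_nonneg (by positivity), mulVec_transpose]
    nth_rw 3 [← hT2]
    field_simp
  · filter_upwards [hR.pos_s, hR.pos_q, hR.one_le_b] with k hs hq hb
    have hb0 : 0 < Real.sqrt ((N k : ℝ) ^ α) := by linarith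
    rw [abs_of_nonneg (by positivity)]
    refine (mul_le_mul_of_nonneg_left (δ_inv_le hs hq) (by positivity)).trans_eq ?_
    field_simp

lemma isBigOp_row_factor (h : AssumptionA3 P m N T M α) (hR : SizeRates N T α) (t : ℕ) :
    IsBigOp P (fun k ω => vnorm ((m.scaledF (T k) ω)ᵀ *ᵥ
        (m.scaledE α (N k) (T k) ω *ᵥ m.eTime (N k) t ω)))
      (fun k => (1 + Real.sqrt (N k) ^ 2 / Real.sqrt (T k) ^ 2) /
        Real.sqrt ((N k : ℝ) ^ α)) := by
  refine (h.row_factor t).of_eq_mul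
    (c := fun k => Real.sqrt (N k) ^ 2 / Real.sqrt ((N k : ℝ) ^ α))
    (Eventually.of_forall fun k => inv_nonneg.2 (sq_nonneg _)) ?_ ?_
  · filter_upwards [hR.pos_s, hR.pos_q, hR.one_le_b] with k hs hq hb ω
    have hb0 : 0 < Real.sqrt ((N k : ℝ) ^ α) := by linarith
    have hN2 : Real.sqrt (N k) ^ 2 = N k := Real.sq_sqrt (Nat.cast_nonneg _)
    have hT2 : Real.sqrt (T k) ^ 2 = T k := Real.sq_sqrt (Nat.cast_nonneg _)
    have hden : (N k : ℝ) * T k = Real.sqrt (N k) ^ 2 * Real.sqrt (T k) ^ 2 := by rw [hN2, hT2]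
    rw [FactorModel.scaledE, FactorModel.scaledF, transpose_smul, smul_mulVec, smul_mulVec,
      mulVec_smul, vnorm_smul, vnorm_smul, abs_of_nonneg (by positivity),
      abs_of_nonneg (by positivity), vecMul_transpose, mulVec_transpose, hden]
    field_simp
  · filter_upwards [hR.pos_s, hR.pos_q, hR.one_le_b] with k hs hq hb
    have hb0 : 0 < Real.sqrt ((N k : ℝ) ^ α) := by linarith
    rw [abs_of_nonneg (by positivity)]
    refine (mul_le_mul_of_nonneg_left (δ_sq_inv_le hs hq) (by positivity)).trans_eq ?_
    field_simp

lemma isBigOp_col_loading (h : AssumptionA3 P m N T M α) (hR : SizeRates N T α) (i : ℕ) :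
    IsBigOp P (fun k ω => vnorm ((m.scaledΛ α (N k) ω)ᵀ *ᵥ
        ((m.scaledE α (N k) (T k) ω)ᵀ *ᵥ m.eUnit (T k) i ω)))
      (fun k => Real.sqrt (T k) / Real.sqrt ((N k : ℝ) ^ α) ^ 2 +
        1 / Real.sqrt ((N k : ℝ) ^ α)) := by
  have hb2 : ∀ k, (N k : ℝ) ^ α = Real.sqrt ((N k : ℝ) ^ α) ^ 2 := fun k =>
    (Real.sq_sqrt (by positivity)).symm
  have hT2 : ∀ k, (T k : ℝ) = Real.sqrt (T k) ^ 2 := fun k => (Real.sq_sqrt (by positivity)).symm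
  refine (h.col_loading i).of_eq_mul (c := fun k => Real.sqrt (T k))
    (Eventually.of_forall fun k => by positivity) ?_ ?_
  · filter_upwards [hR.pos_s, hR.pos_q, hR.one_le_b] with k hs hq hb ω
    have hb0 : 0 < Real.sqrt ((N k : ℝ) ^ α) := by linarith
    have hden : (N k : ℝ) ^ α * T k = Real.sqrt ((N k : ℝ) ^ α) ^ 2 * Real.sqrt (T k) ^ 2 := by
      rw [← hb2, ← hT2]
    rw [FactorModel.scaledE, FactorModel.scaledΛ, transpose_smul, transpose_smul, smul_mulVec,
      smul_mulVec, mulVec_smul, vnorm_smul, vnorm_smul, abs_of_nonneg (by positivity),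
      abs_of_nonneg (by positivity), mulVec_transpose, mulVec_transpose, hden]
    field_simp
  · filter_upwards [hR.pos_s, hR.pos_q, hR.one_le_b] with k hs hq hb
    have hb0 : 0 < Real.sqrt ((N k : ℝ) ^ α) := by linarith
    rw [abs_of_nonneg (by positivity), Real.sqrt_mul (by positivity)]
    nth_rw 1 [hb2 k]
    refine le_of_eq ?_
    field_simp

end Orders

/-! ### Negligibility of the remainders -/

section Remainder

variable {r : ℕ} {Q : Matrix (Fin r) (Fin r) ℝ} {v : Fin r → ℝ} {β : Type*} {l : Filter β}
  {N T : β → ℕ} {F Ft : ∀ b, Matrix (Fin (T b)) (Fin r) ℝ}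
  {L Lt : ∀ b, Matrix (Fin (N b)) (Fin r) ℝ} {E : ∀ b, Matrix (Fin (T b)) (Fin (N b)) ℝ}
  {w : β → Fin r → ℝ}

lemma tendsto_frobNorm {A : β → Matrix (Fin r) (Fin r) ℝ} {B : Matrix (Fin r) (Fin r) ℝ}
    (h : Tendsto A l (𝓝 B)) :
    Tendsto (fun b => frobNorm (A b)) l (𝓝 (frobNorm B)) :=
  (continuous_frobNorm.tendsto B).comp h

lemma eventually_ne_zero (hw : Tendsto w l (𝓝 v)) (hv0 : ∀ j, 0 < v j) :
    ∀ᶠ b in l, ∀ j, w b j ≠ 0 :=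
  eventually_all.2 fun j => (tendsto_pi_nhds.1 hw j).eventually_ne (hv0 j).ne'

lemma tendsto_factor_sub
    (hPC : ∀ᶠ b in l, PCProps 1 (F b * (L b)ᵀ + E b) (Ft b) (Lt b) (w b))
    (hA : Tendsto (fun b => (Ft b)ᵀ * F b) l (𝓝 Q)) (hw : Tendsto w l (𝓝 v))
    (hv0 : ∀ j, 0 < v j) {u : ∀ b, Fin (T b) → ℝ}
    (h1 : Tendsto (fun b => vnorm ((L b)ᵀ *ᵥ ((E b)ᵀ *ᵥ u b))) l (𝓝 0))
    (h2 : Tendsto (fun b => spNorm (E b) * vnorm ((E b)ᵀ *ᵥ u b)) l (𝓝 0)) :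
    Tendsto (fun b => vnorm ((Ft b)ᵀ *ᵥ u b -
      ((L b)ᵀ * Lt b * diagonal (w b)⁻¹)ᵀ *ᵥ ((F b)ᵀ *ᵥ u b))) l (𝓝 0) := by
  have h3 := (tendsto_frobNorm (tendsto_diagonal_inv hw hv0)).mul
    (((tendsto_frobNorm hA).mul h1).add (h2.const_mul (Real.sqrt r)))
  simp only [mul_zero, add_zero] at h3
  refine squeeze_zero' (Eventually.of_forall fun _ => vnorm_nonneg _) ?_ h3
  filter_upwards [hPC, eventually_ne_zero hw hv0] with b hb hb0
  exact hb.vnorm_factor_sub_le hb0 (u b)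

lemma tendsto_factor_zero {R : Matrix (Fin r) (Fin r) ℝ}
    (hPC : ∀ᶠ b in l, PCProps 1 (F b * (L b)ᵀ + E b) (Ft b) (Lt b) (w b))
    (hA : Tendsto (fun b => (Ft b)ᵀ * F b) l (𝓝 Q)) (hw : Tendsto w l (𝓝 v))
    (hv0 : ∀ j, 0 < v j)
    (hH : Tendsto (fun b => (L b)ᵀ * Lt b * diagonal (w b)⁻¹) l (𝓝 R)) {u : ∀ b, Fin (T b) → ℝ}
    (h1 : Tendsto (fun b => vnorm ((F b)ᵀ *ᵥ u b)) l (𝓝 0))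
    (h2 : Tendsto (fun b => frobNorm (E b * L b) * vnorm (u b)) l (𝓝 0))
    (h3 : Tendsto (fun b => spNorm (E b) * spNorm (E b) * vnorm (u b)) l (𝓝 0)) :
    Tendsto (fun b => vnorm ((Ft b)ᵀ *ᵥ u b)) l (𝓝 0) := by
  have h4 : Tendsto (fun b => vnorm ((L b)ᵀ *ᵥ ((E b)ᵀ *ᵥ u b))) l (𝓝 0) := by
    refine squeeze_zero (fun _ => vnorm_nonneg _) (fun b => ?_) h2
    rw [mulVec_mulVec, ← transpose_mul, ← frobNorm_transpose]
    exact vnorm_mulVec_le _ _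
  have h5 : Tendsto (fun b => spNorm (E b) * vnorm ((E b)ᵀ *ᵥ u b)) l (𝓝 0) := by
    refine squeeze_zero (fun b => mul_nonneg (spNorm_nonneg _) (vnorm_nonneg _)) (fun b => ?_) h3
    rw [mul_assoc]
    refine mul_le_mul_of_nonneg_left ?_ (spNorm_nonneg _)
    rw [← spNorm_transpose]
    exact vnorm_mulVec_le_spNorm _ _
  have h6 := (tendsto_factor_sub hPC hA hw hv0 h4 h5).add ((tendsto_frobNorm hH).mul h1)
  simp only [mul_zero, add_zero] at h6
  refine squeeze_zero (fun _ => vnorm_nonneg _) (fun b => ?_) h6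
  have h7 := vnorm_add_le ((Ft b)ᵀ *ᵥ u b -
    ((L b)ᵀ * Lt b * diagonal (w b)⁻¹)ᵀ *ᵥ ((F b)ᵀ *ᵥ u b))
    (((L b)ᵀ * Lt b * diagonal (w b)⁻¹)ᵀ *ᵥ ((F b)ᵀ *ᵥ u b))
  rw [sub_add_cancel] at h7
  refine h7.trans (add_le_add le_rfl ((vnorm_mulVec_le _ _).trans_eq ?_))
  rw [frobNorm_transpose]

end Remainder

/-! ### The rotation matrices -/

section Rotations

variable {r : ℕ}

lemma H₄_eq {N : ℕ} {b : ℝ} {Λt Λ : Matrix (Fin N) (Fin r) ℝ} {w : Fin r → ℝ}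
    (hw : ∀ j, w j ≠ 0) (hG : (b⁻¹ • Λt)ᵀ * (b⁻¹ • Λt) = diagonal w) :
    H₄ Λt Λ = (b⁻¹ • Λ)ᵀ * (b⁻¹ • Λt) * diagonal w⁻¹ := by
  rw [transpose_smul, Matrix.smul_mul, Matrix.mul_smul, smul_smul] at hG ⊢
  have h1 : (Λtᵀ * Λt)⁻¹ = (b⁻¹ * b⁻¹) • diagonal w⁻¹ := by
    refine inv_eq_right_inv ?_
    rw [Matrix.mul_smul, ← Matrix.smul_mul, hG, diagonal_mul_inv hw]
  rw [H₄, h1, Matrix.mul_smul, Matrix.smul_mul]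

lemma H₃_inv_eq {T : ℕ} {q : ℝ} (hq : q ≠ 0) {Ft F : Matrix (Fin T) (Fin r) ℝ}
    (hG : (q⁻¹ • Ft)ᵀ * (q⁻¹ • Ft) = 1) (hA : IsUnit ((q⁻¹ • Ft)ᵀ * (q⁻¹ • F))) :
    (H₃ Ft F)⁻¹ = (q⁻¹ • Ft)ᵀ * (q⁻¹ • F) := by
  have hsc : ∀ B : Matrix (Fin T) (Fin r) ℝ, Ftᵀ * B = (q * q) • ((q⁻¹ • Ft)ᵀ * (q⁻¹ • B)) := by
    intro B
    rw [transpose_smul, Matrix.smul_mul, Matrix.mul_smul, smul_smul, smul_smul,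
      mul_assoc q q, mul_inv_cancel₀ hq, mul_one, mul_inv_cancel₀ hq, one_smul]
  set A := (q⁻¹ • Ft)ᵀ * (q⁻¹ • F) with hAdef
  have hA' : IsUnit ((q * q) • A).det := by
    rw [det_smul]
    exact ((isUnit_iff_ne_zero.2 (mul_ne_zero hq hq)).pow _).mul ((isUnit_iff_isUnit_det _).1 hA)
  refine inv_eq_right_inv ?_
  rw [H₃, hsc F, hsc Ft, hG, ← hAdef, Matrix.mul_assoc, Matrix.smul_mul, Matrix.one_mul,
    nonsing_inv_mul _ hA']

variable {Ω : Type*} [MeasurableSpace Ω]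

lemma measurable_matrix_mul {ι κ μ : Type*} [Fintype κ] {A : Ω → Matrix ι κ ℝ}
    {B : Ω → Matrix κ μ ℝ} (hA : ∀ i j, Measurable fun ω => A ω i j)
    (hB : ∀ i j, Measurable fun ω => B ω i j) (i : ι) (j : μ) :
    Measurable fun ω => (A ω * B ω) i j := by
  simp only [mul_apply]
  exact Finset.measurable_sum _ fun k _ => (hA i k).mul (hB k j)

lemma measurable_matrix_det {A : Ω → Matrix (Fin r) (Fin r) ℝ}
    (hA : ∀ i j, Measurable fun ω => A ω i j) : Measurable fun ω => (A ω).det := by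
  simp only [det_apply]
  exact Finset.measurable_sum _ fun σ _ =>
    (Finset.measurable_prod _ fun i _ => hA (σ i) i).const_smul (Equiv.Perm.sign σ)

lemma measurable_matrix_inv {A : Ω → Matrix (Fin r) (Fin r) ℝ}
    (hA : ∀ i j, Measurable fun ω => A ω i j) (i j : Fin r) :
    Measurable fun ω => (A ω)⁻¹ i j := by
  simp only [inv_def, Ring.inverse_eq_inv', Matrix.smul_apply, smul_eq_mul, adjugate_apply]
  refine (measurable_matrix_det hA).inv.mul (measurable_matrix_det fun i' j' => ?_)
  by_cases h : i' = j
  · subst h; simp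
  · simpa [updateRow_ne h] using hA i' j'

lemma measurable_mulVec_toLp {A : Ω → Matrix (Fin r) (Fin r) ℝ} {x : Ω → EuclideanSpace ℝ (Fin r)}
    (hA : ∀ i j, Measurable fun ω => A ω i j) (hx : Measurable x) :
    Measurable fun ω => WithLp.toLp 2 (A ω *ᵥ (x ω).ofLp) := by
  refine (WithLp.measurable_toLp 2 _).comp (measurable_pi_iff.2 fun i => ?_)
  simp only [mulVec, dotProduct]
  exact Finset.measurable_sum _ fun j _ => (hA i j).mul ((by fun_prop :
    Measurable fun y : EuclideanSpace ℝ (Fin r) => y.ofLp j).comp hx)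

lemma measurable_rows {n : ℕ} {f : ℕ → Ω → EuclideanSpace ℝ (Fin r)} (hf : ∀ i, Measurable (f i))
    (i : Fin n) (j : Fin r) : Measurable fun ω => rows n (fun i => f i ω) i j :=
  (by fun_prop : Measurable fun y : EuclideanSpace ℝ (Fin r) => y.ofLp j).comp (hf i)

end Rotations

/-! ### Limit distributions of the estimators -/

section Main

variable {Ω : Type*} [MeasurableSpace Ω] {P : Measure Ω} {r : ℕ}
  {m : FactorModel Ω r} {N T : ℕ → ℕ} {M α : ℝ} {SF SΛ Q : Matrix (Fin r) (Fin r) ℝ}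
  {v : Fin r → ℝ}

/-- The vectors `f i`, `i < n`, divided by `c`, as the rows of a matrix. -/
def scaledRows (c : ℝ) (n : ℕ) (f : ℕ → EuclideanSpace ℝ (Fin r)) : Matrix (Fin n) (Fin r) ℝ :=
  c⁻¹ • rows n f

/-- The diagonal of the Gram matrix of the estimated loadings, divided by `N ^ α`: these are the
scaled leading eigenvalues. -/
def scaledEigenvalues (N : ℕ) (α : ℝ) (Λt : ℕ → EuclideanSpace ℝ (Fin r)) (j : Fin r) : ℝ :=
  ((scaledRows (Real.sqrt ((N : ℝ) ^ α)) N Λt)ᵀ *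
    scaledRows (Real.sqrt ((N : ℝ) ^ α)) N Λt) j j

lemma IsPC.scaled {n t : ℕ} (hn : 0 < n) (ht : 0 < t) {hrT : r ≤ t} {hrN : r ≤ n} {ω : Ω}
    {Ft Λt : ℕ → EuclideanSpace ℝ (Fin r)} (h : IsPC hrT hrN (m.X n t ω) (rows t Ft) (rows n Λt)) :
    PCProps 1 (m.scaledF t ω * (m.scaledΛ α n ω)ᵀ + m.scaledE α n t ω)
      (scaledRows (Real.sqrt t) t Ft) (scaledRows (Real.sqrt ((n : ℝ) ^ α)) n Λt)
      (scaledEigenvalues n α Λt) := by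
  obtain ⟨w, hw⟩ := h.props ht hn
  have hn' : (0 : ℝ) < n := by exact_mod_cast hn
  have h1 := hw.normalize (by exact_mod_cast ht) (Real.rpow_pos_of_pos hn' α)
  rw [m.scaled_X] at h1
  have h2 : scaledEigenvalues n α Λt = ((n : ℝ) ^ α)⁻¹ • w := by
    ext j
    have := congrFun (congrFun h1.gram_loading j) j
    rwa [diagonal_apply_eq] at this
  rw [h2]
  exact h1

/-- The estimation error of the factors at time `t`, exactly. -/
lemma factor_error_eq {n τ t : ℕ} (ht : t < τ) (hn : 0 < n) {ω : Ω}
    {Ft Λt : ℕ → EuclideanSpace ℝ (Fin r)}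
    (h : PCProps 1 (m.scaledF τ ω * (m.scaledΛ α n ω)ᵀ + m.scaledE α n τ ω)
      (scaledRows (Real.sqrt τ) τ Ft) (scaledRows (Real.sqrt ((n : ℝ) ^ α)) n Λt)
      (scaledEigenvalues n α Λt))
    (hw : ∀ j, scaledEigenvalues n α Λt j ≠ 0) :
    Real.sqrt ((n : ℝ) ^ α) • (Ft t - WithLp.toLp 2
        ((H₄ (rows n Λt) (m.Λmat n ω))ᵀ *ᵥ (m.F t ω).ofLp)) =
      WithLp.toLp 2 (diagonal (scaledEigenvalues n α Λt)⁻¹ *ᵥ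
        (((scaledRows (Real.sqrt τ) τ Ft)ᵀ * m.scaledF τ ω) *ᵥ (m.crossSum α n t ω).ofLp +
          (scaledRows (Real.sqrt τ) τ Ft)ᵀ *ᵥ (m.scaledE α n τ ω *ᵥ m.eTime n t ω))) := by
  have hb : Real.sqrt ((n : ℝ) ^ α) ≠ 0 :=
    (Real.sqrt_pos.2 (Real.rpow_pos_of_pos (by exact_mod_cast hn) α)).ne'
  have hq : Real.sqrt τ ≠ 0 := (Real.sqrt_pos.2 (by exact_mod_cast (Nat.zero_le t).trans_lt ht)).ne'
  have hH := H₄_eq (Λ := m.Λmat n ω) hw h.gram_loading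
  have h1 := h.factor_row hw ⟨t, ht⟩
  have hE : m.scaledE α n τ ω ⟨t, ht⟩ =
      ((Real.sqrt ((n : ℝ) ^ α))⁻¹ * (Real.sqrt τ)⁻¹) • m.eTime n t ω := rfl
  have hF1 : scaledRows (Real.sqrt τ) τ Ft ⟨t, ht⟩ = (Real.sqrt τ)⁻¹ • (Ft t).ofLp := rfl
  have hF2 : m.scaledF τ ω ⟨t, ht⟩ = (Real.sqrt τ)⁻¹ • (m.F t ω).ofLp := rfl
  change H₄ (rows n Λt) (m.Λmat n ω) = (m.scaledΛ α n ω)ᵀ *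
    scaledRows (Real.sqrt ((n : ℝ) ^ α)) n Λt * diagonal (scaledEigenvalues n α Λt)⁻¹ at hH
  rw [hE, hF1, hF2, ← hH, mulVec_smul, ← smul_sub, mulVec_smul, mulVec_smul, mulVec_smul,
    mulVec_smul, ← smul_add, mulVec_smul, ← FactorModel.crossSum_eq] at h1
  have h2 := congrArg (fun y => (Real.sqrt ((n : ℝ) ^ α) * Real.sqrt τ) • y) h1
  simp only [smul_smul] at h2
  rw [mul_inv_cancel_right₀ hq, ← mul_inv, mul_inv_cancel₀ (mul_ne_zero hb hq), one_smul] at h2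
  rw [← h2]
  rfl

/-- The estimation error of the loadings of unit `i`, exactly. -/
lemma loading_error_eq {n τ i : ℕ} (hi : i < n) (hτ : 0 < τ) {ω : Ω}
    {Ft Λt : ℕ → EuclideanSpace ℝ (Fin r)}
    (h : PCProps 1 (m.scaledF τ ω * (m.scaledΛ α n ω)ᵀ + m.scaledE α n τ ω)
      (scaledRows (Real.sqrt τ) τ Ft) (scaledRows (Real.sqrt ((n : ℝ) ^ α)) n Λt)
      (scaledEigenvalues n α Λt))
    (hA : IsUnit ((scaledRows (Real.sqrt τ) τ Ft)ᵀ * m.scaledF τ ω)) :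
    Real.sqrt τ • (Λt i - WithLp.toLp 2
        ((H₃ (rows τ Ft) (m.Fmat τ ω))⁻¹ *ᵥ (m.Λ n i ω).ofLp)) =
      WithLp.toLp 2 ((scaledRows (Real.sqrt τ) τ Ft)ᵀ *ᵥ m.eUnit τ i ω) := by
  have hn : (0 : ℝ) < n := by exact_mod_cast (Nat.zero_le i).trans_lt hi
  have hb : Real.sqrt ((n : ℝ) ^ α) ≠ 0 := (Real.sqrt_pos.2 (Real.rpow_pos_of_pos hn α)).ne'
  have hq : Real.sqrt τ ≠ 0 := (Real.sqrt_pos.2 (by exact_mod_cast hτ)).ne'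
  have hG := h.gram_factor
  rw [one_smul] at hG
  have hH : (H₃ (rows τ Ft) (m.Fmat τ ω))⁻¹ =
      (scaledRows (Real.sqrt τ) τ Ft)ᵀ * m.scaledF τ ω := H₃_inv_eq hq hG hA
  have h1 := h.loading_row ⟨i, hi⟩
  have hE : (m.scaledE α n τ ω)ᵀ ⟨i, hi⟩ =
      ((Real.sqrt ((n : ℝ) ^ α))⁻¹ * (Real.sqrt τ)⁻¹) • m.eUnit τ i ω := rfl
  have hL1 : scaledRows (Real.sqrt ((n : ℝ) ^ α)) n Λt ⟨i, hi⟩ =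
      (Real.sqrt ((n : ℝ) ^ α))⁻¹ • (Λt i).ofLp := rfl
  have hL2 : m.scaledΛ α n ω ⟨i, hi⟩ = (Real.sqrt ((n : ℝ) ^ α))⁻¹ • (m.Λ n i ω).ofLp := rfl
  rw [hE, hL1, hL2, ← hH, mulVec_smul, ← smul_sub, mulVec_smul] at h1
  have h2 := congrArg (fun y => (Real.sqrt τ * Real.sqrt ((n : ℝ) ^ α)) • y) h1
  simp only [smul_smul] at h2
  rw [mul_inv_cancel_right₀ hb, mul_comm (Real.sqrt τ), ← mul_inv, mul_inv_cancel₀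
    (mul_ne_zero hb hq), one_smul] at h2
  rw [← h2]
  rfl

variable {Ft Λt : ℕ → ℕ → Ω → EuclideanSpace ℝ (Fin r)}

lemma eventually_pcProps (hN : Tendsto N atTop atTop) (hT : Tendsto T atTop atTop)
    (hPC : ∀ k, ∀ (hrT : r ≤ T k) (hrN : r ≤ N k), ∀ᵐ ω ∂P,
      IsPC hrT hrN (m.X (N k) (T k) ω) (rows (T k) fun t => Ft k t ω)
        (rows (N k) fun i => Λt k i ω)) :
    ∀ᶠ x : ℕ × Ω in whp P,
      PCProps 1 (m.scaledF (T x.1) x.2 * (m.scaledΛ α (N x.1) x.2)ᵀ +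
          m.scaledE α (N x.1) (T x.1) x.2)
        (scaledRows (Real.sqrt (T x.1)) (T x.1) fun t => Ft x.1 t x.2)
        (scaledRows (Real.sqrt ((N x.1 : ℝ) ^ α)) (N x.1) fun i => Λt x.1 i x.2)
        (scaledEigenvalues (N x.1) α fun i => Λt x.1 i x.2) := by
  refine eventually_whp_of_ae ?_
  filter_upwards [hN.eventually_ge_atTop r, hT.eventually_ge_atTop r, hN.eventually_gt_atTop 0,
    hT.eventually_gt_atTop 0] with k h1 h2 h3 h4
  filter_upwards [hPC k h2 h1] with ω hω
  exact hω.scaled h3 h4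

lemma AssumptionA2.tendsto_gram_factor (h : AssumptionA2 P m N T M α SF SΛ) :
    Tendsto (fun x : ℕ × Ω => (m.scaledF (T x.1) x.2)ᵀ * m.scaledF (T x.1) x.2) (whp P)
      (𝓝 SF) := by
  refine h.factor_limit.tendsto_whp.congr fun x => ?_
  rw [FactorModel.scaledF, transpose_smul, Matrix.smul_mul, Matrix.mul_smul, smul_smul, ← mul_inv,
    Real.mul_self_sqrt (Nat.cast_nonneg _), one_div]

lemma AssumptionA2.tendsto_gram_loading (h : AssumptionA2 P m N T M α SF SΛ) :
    Tendsto (fun x : ℕ × Ω => (m.scaledΛ α (N x.1) x.2)ᵀ * m.scaledΛ α (N x.1) x.2) (whp P)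
      (𝓝 SΛ) := by
  refine h.loading_limit.tendsto_whp.congr fun x => ?_
  rw [FactorModel.scaledΛ, transpose_smul, Matrix.smul_mul, Matrix.mul_smul, smul_smul, ← mul_inv,
    Real.mul_self_sqrt (by positivity), one_div]

end Main

end WeakFactor

end

open WeakFactor
theorem proposition4 {Ω : Type*} [MeasurableSpace Ω] (P : Measure Ω) [IsProbabilityMeasure P]
    {r : ℕ} (m : FactorModel Ω r)
    (N T : ℕ → ℕ) (hN : Tendsto N atTop atTop) (hT : Tendsto T atTop atTop)
    (M α : ℝ) (SF SΛ : Matrix (Fin r) (Fin r) ℝ) (Γ Φ : ℕ → Matrix (Fin r) (Fin r) ℝ)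
    (hA : AssumptionA P m N T M α SF SΛ) (hB : AssumptionB P m N T α Γ Φ)
    (hC : AssumptionC N T α)
    (v : Fin r → ℝ) (hv : IsOrderedEigenvalues (SΛ * SF) v)
    (Υ : Matrix (Fin r) (Fin r) ℝ) (hΥ : IsEigenvectorMatrix SF SΛ v Υ)
    (Ft Λt : ℕ → ℕ → Ω → EuclideanSpace ℝ (Fin r))
    (hFt : ∀ k t, Measurable (Ft k t)) (hΛt : ∀ k i, Measurable (Λt k i))
    (hPC : ∀ k, ∀ (hrT : r ≤ T k) (hrN : r ≤ N k), ∀ᵐ ω ∂P,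
      IsPC hrT hrN (m.X (N k) (T k) ω) (rows (T k) fun t => Ft k t ω)
        (rows (N k) fun i => Λt k i ω))
    (hsign : ∀ k, ∀ᵐ ω ∂P, ∀ j : Fin r,
      0 ≤ ((rows (T k) fun t => Ft k t ω)ᵀ * m.Fmat (T k) ω * (Qmat SΛ v Υ)ᵀ) j j) :
    (∀ t : ℕ, TendstoNormal P
      (fun k ω => Real.sqrt ((N k : ℝ) ^ α) • (Ft k t ω - WithLp.toLp 2
        ((H₄ (rows (N k) fun i => Λt k i ω) (m.Λmat (N k) ω))ᵀ *ᵥ (m.F t ω).ofLp)))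
      ((Dmat v ^ 2)⁻¹ * Qmat SΛ v Υ * Γ t * (Qmat SΛ v Υ)ᵀ * (Dmat v ^ 2)⁻¹)) ∧
    (∀ i : ℕ, TendstoNormal P
      (fun k ω => Real.sqrt (T k) • (Λt k i ω - WithLp.toLp 2
        ((H₃ (rows (T k) fun t => Ft k t ω) (m.Fmat (T k) ω))⁻¹ *ᵥ (m.Λ (N k) i ω).ofLp)))
      ((Qmat SΛ v Υ)ᵀ⁻¹ * Φ i * (Qmat SΛ v Υ)⁻¹)) := by
  have hR : SizeRates N T α :=
    rates_of_assumptions hN hT hA.a2.strength_pos hA.a2.strength_le_one hA.a4 hC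
  have hSF := hA.a2.factor_posDef
  have hSΛ := hA.a2.loading_posDef
  have hv0 := eigenvalue_pos hSF hSΛ hΥ
  have hQS := Qmat_gram hSF hSΛ hΥ
  have hQ := Qmat_eigen hSΛ hΥ
  have hD : (Dmat v ^ 2)⁻¹ = diagonal v⁻¹ := by
    rw [Dmat_sq hv0]
    exact inv_eq_right_inv (diagonal_mul_inv fun j => (hv0 j).ne')
  set Q := Qmat SΛ v Υ
  have hPC' := eventually_pcProps (m := m) (α := α) hN hT hPC
  have hsign' : ∀ᶠ x : ℕ × Ω in whp P, ∀ j : Fin r,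
      0 ≤ ((scaledRows (Real.sqrt (T x.1)) (T x.1) fun t => Ft x.1 t x.2)ᵀ *
        m.scaledF (T x.1) x.2 * Qᵀ) j j := by
    refine eventually_whp_of_ae (Eventually.of_forall fun k => ?_)
    filter_upwards [hsign k] with ω hω j
    rw [scaledRows, FactorModel.scaledF, transpose_smul, Matrix.smul_mul, Matrix.mul_smul,
      Matrix.smul_mul, Matrix.smul_mul, Matrix.smul_apply, Matrix.smul_apply]
    exact smul_nonneg (by positivity) (smul_nonneg (by positivity) (hω j))
  -- Orders of the error terms.
  have hb0 : ∀ᶠ k in atTop, 0 ≤ 1 / Real.sqrt ((N k : ℝ) ^ α) :=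
    Eventually.of_forall fun k => by positivity
  have oEL := isBigOp_loading_noise hA.a3 hR
  have oE := isBigOp_spectral (α := α) hA.a1
  have hE0 : ∀ᶠ k in atTop, 0 ≤ (Real.sqrt (N k) + Real.sqrt (T k)) /
      (Real.sqrt ((N k : ℝ) ^ α) * Real.sqrt (T k)) :=
    Eventually.of_forall fun k => by positivity
  have tEL := oEL.tendsto_zero hb0 hR.inv_b
  have tE := oE.tendsto_zero hE0 hR.spectral
  -- Consistency.
  obtain ⟨tA, tw⟩ := tendsto_overlap hPC' hA.a2.tendsto_gram_factor hSF
    hA.a2.tendsto_gram_loading hSΛ tEL tE hsign' hQ hQS hv.antitone hv0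
    (hv.injective hA.a2.distinct)
  have tH := tendsto_rotation hPC' hA.a2.tendsto_gram_loading tEL tA tw hQS hv0
  have tWi := tendsto_diagonal_inv tw hv0
  have hw0 := eventually_ne_zero tw hv0
  constructor
  · intro t
    have oRow := isBigOp_row hA.a1 hR t
    have hrow0 : ∀ᶠ k in atTop, 0 ≤ (Real.sqrt (N k) + Real.sqrt (N k) ^ 2 / Real.sqrt (T k)) /
        Real.sqrt ((N k : ℝ) ^ α) := Eventually.of_forall fun k => by positivity
    have t1 := (isBigOp_row_factor hA.a3 hR t).tendsto_zero
      (Eventually.of_forall fun k => by positivity) hR.factor_noise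
    have t2 := (oEL.mul oRow hb0 hrow0).tendsto_zero
      (by filter_upwards [hb0, hrow0] with k h1 h2 using mul_nonneg h1 h2) hR.loading_noise_mul
    have t3 := ((oE.mul oE hE0 hE0).mul oRow
      (by filter_upwards [hE0] with k h1 using mul_nonneg h1 h1) hrow0).tendsto_zero
      (by filter_upwards [hE0, hrow0] with k h1 h2 using mul_nonneg (mul_nonneg h1 h1) h2)
      hR.spectral_sq_mul
    have tRem := tendsto_factor_zero hPC' tA tw hv0 tH t1 t2 t3
    have hcov : (Dmat v ^ 2)⁻¹ * Q * Γ t * Qᵀ * (Dmat v ^ 2)⁻¹ =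
        (diagonal v⁻¹ * Q) * Γ t * (diagonal v⁻¹ * Q)ᵀ := by
      rw [hD, transpose_mul, diagonal_transpose]
      simp only [Matrix.mul_assoc]
    rw [hcov]
    refine TendstoNormal.slutsky (Z := fun k => m.crossSum α (N k) t)
      (Bk := fun k ω => diagonal (scaledEigenvalues (N k) α fun i => Λt k i ω)⁻¹ *
        ((scaledRows (Real.sqrt (T k)) (T k) fun t => Ft k t ω)ᵀ * m.scaledF (T k) ω))
      (hB.posDef_Γ t).posSemidef (hB.clt_cross t) (hA.a3.isBigOp_crossSum hT t) (tWi.mul tA) ?_ ?_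
    · have hlim := (tendsto_frobNorm tWi).mul tRem
      rw [mul_zero] at hlim
      refine squeeze_zero' (Eventually.of_forall fun _ => norm_nonneg _) ?_ hlim
      filter_upwards [hPC', hw0, tendsto_fst_whp.eventually (hT.eventually_gt_atTop t),
        tendsto_fst_whp.eventually (hN.eventually_gt_atTop 0)] with x h1 h2 h3 h4
      rw [factor_error_eq h3 h4 h1 h2, mulVec_add, WithLp.toLp_add, mulVec_mulVec,
        add_sub_cancel_left]
      exact vnorm_mulVec_le _ _
    · intro k
      refine (((hFt k t).sub (measurable_mulVec_toLp (fun i j => ?_) (m.measurable_F t))).const_smul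
        (Real.sqrt ((N k : ℝ) ^ α))).aemeasurable
      have mΛ := measurable_rows (n := N k) (hΛt k)
      exact measurable_matrix_mul (measurable_matrix_mul
        (fun a b => measurable_rows (m.measurable_Λ (N k)) b a) mΛ)
        (measurable_matrix_inv (measurable_matrix_mul (fun a b => mΛ b a) mΛ)) j i
  · intro i
    have oCol := isBigOp_col hA.a1 hR i
    have hcol0 : ∀ᶠ k in atTop, 0 ≤ (Real.sqrt (T k) + Real.sqrt (N k)) /
        Real.sqrt ((N k : ℝ) ^ α) := Eventually.of_forall fun k => by positivity
    have t1 := (isBigOp_col_loading hA.a3 hR i).tendsto_zero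
      (Eventually.of_forall fun k => by positivity) hR.loading_noise
    have t2 := (oE.mul oCol hE0 hcol0).tendsto_zero
      (by filter_upwards [hE0, hcol0] with k h1 h2 using mul_nonneg h1 h2) hR.spectral_mul
    have tRem := tendsto_factor_sub hPC' tA tw hv0 t1 t2
    have hQu : IsUnit Q.det := by
      rw [isUnit_iff_ne_zero]
      intro h0
      have h1 := congrArg det hQS
      rw [det_mul, det_mul, h0, zero_mul, zero_mul, det_diagonal] at h1
      exact (Finset.prod_pos fun j _ => hv0 j).ne h1
    have hAu : ∀ᶠ x : ℕ × Ω in whp P,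
        IsUnit ((scaledRows (Real.sqrt (T x.1)) (T x.1) fun t => Ft x.1 t x.2)ᵀ *
          m.scaledF (T x.1) x.2) := by
      have h1 := (continuous_id.matrix_det.tendsto Q).comp tA
      filter_upwards [h1.eventually_ne hQu.ne_zero] with x hx
      rw [isUnit_iff_isUnit_det]
      exact isUnit_iff_ne_zero.2 hx
    have hcov : Qᵀ⁻¹ * Φ i * Q⁻¹ = (Q⁻¹)ᵀ * Φ i * ((Q⁻¹)ᵀ)ᵀ := by
      rw [transpose_transpose, transpose_nonsing_inv]
    rw [hcov]
    refine TendstoNormal.slutsky (Z := fun k => m.timeSum (T k) i)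
      (Bk := fun k ω => ((m.scaledΛ α (N k) ω)ᵀ *
        (scaledRows (Real.sqrt ((N k : ℝ) ^ α)) (N k) fun i => Λt k i ω) *
          diagonal (scaledEigenvalues (N k) α fun i => Λt k i ω)⁻¹)ᵀ)
      (hB.posDef_Φ i).posSemidef (hB.clt_time i) (hA.a3.isBigOp_timeSum hN i)
      ((continuous_id.matrix_transpose.tendsto _).comp tH) ?_ ?_
    · refine tRem.congr' ?_
      filter_upwards [hPC', hAu, tendsto_fst_whp.eventually (hN.eventually_gt_atTop i),
        tendsto_fst_whp.eventually (hT.eventually_gt_atTop 0)] with x h1 h2 h3 h4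
      rw [loading_error_eq h3 h4 h1 h2, FactorModel.timeSum_eq, ← WithLp.toLp_sub]
      rfl
    · intro k
      refine (((hΛt k i).sub (measurable_mulVec_toLp (fun a b => ?_)
        (m.measurable_Λ (N k) i))).const_smul (Real.sqrt (T k : ℝ))).aemeasurable
      have mF := measurable_rows (n := T k) (hFt k)
      exact measurable_matrix_inv (measurable_matrix_mul
        (measurable_matrix_inv (measurable_matrix_mul (fun a b => mF b a)
          (measurable_rows m.measurable_F)))
        (measurable_matrix_mul (fun a b => mF b a) mF)) a b
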